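/- **Setting.** Let $G,R_1>0$ and let $\rho_0$, $v_0$ be the initial density and radial velocity of a spherical dust cloud of initial areal radius $R_1$. Put $$m(R)=4\pi G\int_0^R\rho_0(s)s^2\,ds,\quad E(R)=\tfrac12 v_0(R)^2-\frac{m(R)}R,\quad c(R)=\frac{2m(R)}{R^3},\quad q(R)=\sqrt{1-\frac{Rv_0(R)^2}{2m(R)}},$$ extended by continuity to $R=0$ (quotients such as $v_0(R)/R$, $c'(R)/R$, $q'(R)/R$ are also understood as limits at $R=0$). Assume: (i) $\rho_0$ and $v_0$ extend to an even, respectively odd, $C^\infty$ function on $\mathbb R$; (ii) $\rho_0>0$ on $[0,R_1)$ and $\rho_0=0$ on $[R_1,\infty)$; (iii) $c'(R)\le 0$ for $R>0$; (iv) $2m(R)/R<1$ for $R>0$; (v) $v_0(R)/R<0$ for $R\ge 0$; (vi) $(v_0(R)/R)^2<c(R)$ for $R\ge 0$; (vii) $q'(R)\ge 0$ for $R>0$; (viii) for every $R\ge0$, $c'(R)/R=0$ implies $q'(R)/R>0$. Let $f:[0,1]\to[0,\pi/2]$, $f(x)=x\sqrt{1-x^2}+\arccos x$, and $$r(\tau,R)=\frac{R}{q(R)^2}\Big[f^{-1}\big(f(q(R))+\sqrt{c(R)}\,q(R)^3\tau\big)\Big]^2,\qquad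 0\le\tau<\tau_s(R):=\frac{\pi/2-f(q(R))}{\sqrt{c(R)}\,q(R)^3}.$$ The Tolman–Bondi metric is $$\mathbf g=-d\tau^2+\frac{dR^2}{\gamma^2}+r^2(d\vartheta^2+\sin^2\vartheta\,d\varphi^2),\qquad \gamma=\frac{\sqrt{1+2E(R)}}{\partial_R r(\tau,R)},$$ and the co-moving observers have four-velocity $\mathbf u=\partial_\tau$. Let $y=\sqrt{r/R}\in(0,1]$ (extended to $R=0$ by continuity). For $R>0$ the Cauchy horizon $y=y_{CH}(R)$ is the first outgoing radial null ray ($d\tau/dR=1/\gamma$) emanating from the central singularity $(\tau,R)=(\tau_s(0),0)$, i.e. $y_{CH}(R)$ is the largest value of $y$ on the shell $R$ among all such rays; $y_{CH}(0)=0$. Put $$D=\{(y,R): R\ge 0,\ y_{CH}(R)<y\le 1\}.$$ Assume that the central singularity is globally naked: the Cauchy horizon reaches the surface of the cloud before the apparent horizon $r=2m$, i.e. $R_1\,y_{CH}(R_1)^2>2m(R_1)$. Let $$\Lambda(y,R)=\frac{2q'(R)}{Rq(R)}h(q(R),y)-\frac{c'(R)}{2Rc(R)}g(q(R),y),\quad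 g(q,y)=\frac{f(qy)-f(q)}{q^3},\quad h(q,y)=\frac1{\sqrt{1-q^2}}-\frac{y^3}{\sqrt{1-q^2y^2}}-\frac32 g(q,y),$$ and $\Lambda_0=\Lambda(0,0)$. An *admissible choice* is a function $\varepsilon\mapsto R(\varepsilon)>0$, $\varepsilon\in(0,1)$, such that, with $y(\varepsilon):=y_{CH}(R(\varepsilon))$, both $R(\varepsilon)$ and $y(\varepsilon)$ tend to $0$ as $\varepsilon\to0$, and for all $0\le R\le R(\varepsilon)$: $y_{CH}(R)^3\ge\frac{3\Lambda_0}{4}R^2(1-\varepsilon)$, and $\Lambda(y,R)\le(1+\varepsilon)\Lambda_0$ whenever $0\le y\le y(\varepsilon)$. Put $$D(\varepsilon)=\{(y,R):0\le R\le R(\varepsilon),\ y_{CH}(R)<y\le y(\varepsilon)\}.$$ For a future-directed, affinely parametrized radial null geodesic with tangent $\boldsymbol\xi$ (outgoing, ingoing, or passing through the centre $R=0$), with emission at a point $e$ and later reception at a point $obs$ by co-moving observers, the redshift factor is $$z=\frac{\nu_e}{\nu_{obs}}-1=\frac{\mathbf g(\mathbf u,\boldsymbol\xi)|_e}{\mathbf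 g(\mathbf u,\boldsymbol\xi)|_{obs}}-1 .$$ **Proposition.** (a) There is a constant $C$, depending only on the data, such that $|z|\le C$ for all such geodesics that run, between $e$ and $obs$, in the part $R\le R_1$ of $D$ inside the dust cloud. (b) Admissible choices exist, and for every admissible choice and all sufficiently small $\varepsilon>0$, $z<0$ (a blueshift) for all such geodesics, with $e\ne obs$, that run between $e$ and $obs$ in $D(\varepsilon)$. -/

import Mathlib

open Set Filter Topology
open scoped ContDiff

noncomputable section

namespace TolmanBondi

/-- `φ(R)/R` for an odd function `φ`, with its limit `φ'(0)` as value at the centre `R = 0`. -/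
def divR (φ : ℝ → ℝ) (R : ℝ) : ℝ := if R = 0 then deriv φ 0 else φ R / R

/-- `f(x) = x √(1 - x²) + arccos x`, strictly decreasing from `[0,1]` onto `[0,π/2]`. -/
def f (x : ℝ) : ℝ := x * √(1 - x ^ 2) + Real.arccos x

/-- The inverse of `f : [0,1] → [0,π/2]`. -/
def fInv : ℝ → ℝ := Function.invFunOn f (Icc 0 1)

/-- `g(q,y) = (f(qy) - f(q)) / q³`. -/
def g (q y : ℝ) : ℝ := (f (q * y) - f q) / q ^ 3

/-- `h(q,y) = 1/√(1-q²) - y³/√(1-q²y²) - (3/2) g(q,y)`. -/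
def h (q y : ℝ) : ℝ :=
  1 / √(1 - q ^ 2) - y ^ 3 / √(1 - q ^ 2 * y ^ 2) - 3 / 2 * g q y

/-- Initial data on the slice `τ = 0`: Newton's constant, the initial density and velocity
profiles (as functions on the whole axis), and the initial areal radius of the cloud. -/
structure InitialData where
  G : ℝ
  ρ₀ : ℝ → ℝ
  v₀ : ℝ → ℝ
  R₁ : ℝ

namespace InitialData

variable (d : InitialData)

/-- Misner-Sharp mass function `m(R) = 4πG ∫₀ᴿ ρ₀(s) s² ds`. -/
def m (R : ℝ) : ℝ := 4 * Real.pi * d.G * ∫ s in (0 : ℝ)..R, d.ρ₀ s * s ^ 2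

/-- Energy profile `E(R) = v₀(R)²/2 - m(R)/R` (equal to `0` at `R = 0`). -/
def E (R : ℝ) : ℝ := d.v₀ R ^ 2 / 2 - d.m R / R

/-- `c(R) = 2m(R)/R³`, with its limit `8πGρ₀(0)/3` as value at `R = 0`. -/
def c (R : ℝ) : ℝ :=
  if R = 0 then 8 * Real.pi * d.G * d.ρ₀ 0 / 3 else 2 * d.m R / R ^ 3

/-- `q(R) = √(1 - R v₀(R)²/(2m(R))) = √(1 - (v₀(R)/R)²/c(R))`. -/
def q (R : ℝ) : ℝ := √(1 - divR d.v₀ R ^ 2 / d.c R)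

/-- The assumptions on the initial data. -/
structure Admissible : Prop where
  G_pos : 0 < d.G
  R₁_pos : 0 < d.R₁
  /-- regular, smooth initial data -/
  smooth_ρ₀ : ContDiff ℝ ∞ d.ρ₀
  even_ρ₀ : ∀ R, d.ρ₀ (-R) = d.ρ₀ R
  smooth_v₀ : ContDiff ℝ ∞ d.v₀
  odd_v₀ : ∀ R, d.v₀ (-R) = -d.v₀ R
  /-- finite, positive density cloud -/
  ρ₀_pos : ∀ R, 0 ≤ R → R < d.R₁ → 0 < d.ρ₀ R
  ρ₀_zero : ∀ R, d.R₁ ≤ R → d.ρ₀ R = 0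
  /-- monotonically decreasing mean density -/
  c_mono : ∀ R, 0 < R → deriv d.c R ≤ 0
  /-- absence of trapped surfaces on the initial slice -/
  untrapped : ∀ R, 0 < R → 2 * d.m R / R < 1
  /-- collapsing cloud -/
  collapsing : ∀ R, 0 ≤ R → divR d.v₀ R < 0
  /-- bounded collapse -/
  bounded : ∀ R, 0 ≤ R → divR d.v₀ R ^ 2 < d.c R
  /-- exclusion of shell-crossing singularities -/
  q_mono : ∀ R, 0 < R → 0 ≤ deriv d.q R
  /-- non-degeneracy condition -/
  nondegenerate : ∀ R, 0 ≤ R → divR (deriv d.c) R = 0 → 0 < divR (deriv d.q) R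

/-- Proper time `τ_s(R)` at which the shell `R` reaches the shell-focusing singularity. -/
def τs (R : ℝ) : ℝ := (Real.pi / 2 - f (d.q R)) / (√(d.c R) * d.q R ^ 3)

/-- `y(τ,R) = √(r(τ,R)/R)`, in the form that also makes sense at `R = 0`. -/
def y (τ R : ℝ) : ℝ := fInv (f (d.q R) + √(d.c R) * d.q R ^ 3 * τ) / d.q R

/-- Areal radius `r(τ,R) = R y(τ,R)² = (R/q²) [f⁻¹(f(q) + √c q³ τ)]²`
(an odd function of `R`). -/
def r (τ R : ℝ) : ℝ := R * d.y τ R ^ 2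

/-- `γ(τ,R) = √(1 + 2E(R)) / r'(τ,R)`, the prime denoting `∂/∂R`. -/
def γ (τ R : ℝ) : ℝ := √(1 + 2 * d.E R) / deriv (fun R' => d.r τ R') R

/-- `Λ(y,R) = 2 (q'/(R q)) h(q,y) - (c'/(2 R c)) g(q,y)`. -/
def Lam (y R : ℝ) : ℝ :=
  2 * (divR (deriv d.q) R / d.q R) * h (d.q R) y
    - divR (deriv d.c) R / (2 * d.c R) * g (d.q R) y

/-! ### Cauchy horizon and maximal development -/

/-- `R ↦ (T R, R)`, `0 < R ≤ a`, is an outgoing radial null ray, `dτ/dR = 1/γ`, which emanates from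
the central singularity `(τ, R) = (τ_s(0), 0)`. -/
structure IsRayFromSingularity (T : ℝ → ℝ) (a : ℝ) : Prop where
  mem : ∀ R ∈ Ioc 0 a, 0 ≤ T R ∧ T R < d.τs R
  ode : ∀ R ∈ Ioc 0 a, HasDerivWithinAt T (1 / d.γ (T R) R) (Ioc 0 a) R
  lim : Tendsto T (𝓝[>] 0) (𝓝 (d.τs 0))

/-- The Cauchy horizon `y = y_CH(R)`: the first light ray emanating from the central singularity.
(`y` decreases with `τ`, so the earliest ray is the one with the largest `y`. The value is `0` at
`R = 0`, and on shells which no such ray reaches.) -/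
def yCH (R : ℝ) : ℝ :=
  sSup {w | 0 < R ∧ ∃ T, d.IsRayFromSingularity T R ∧ w = d.y (T R) R}

/-- The Cauchy horizon reaches the surface of the cloud before the apparent horizon `r = 2m`. -/
def GloballyNaked : Prop := 2 * d.m d.R₁ < d.R₁ * d.yCH d.R₁ ^ 2

/-- The maximal development `D` of the initial slice, `y_CH(R) < y ≤ 1`, as a set of points
`(τ, R)`. -/
def D : Set (ℝ × ℝ) :=
  {p | 0 ≤ p.2 ∧ 0 ≤ p.1 ∧ p.1 < d.τs p.2 ∧ d.yCH p.2 < d.y p.1 p.2}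

/-- The part `0 ≤ R ≤ a`, `y_CH(R) < y ≤ y_CH(a)` of `D`. The regions `D(ε)` are
`d.DR (Rf ε)`. -/
def DR (a : ℝ) : Set (ℝ × ℝ) :=
  {p ∈ d.D | p.2 ≤ a ∧ d.y p.1 p.2 ≤ d.yCH a}

/-- `Rf` is an allowed choice of the function `ε ↦ R(ε)` in the definition of the regions `D(ε)`.
The second condition is `z(R^{1/3}) ≥ -ε`, where
`y_CH(R)³ = (3Λ₀/4) R² [1 + z(R^{1/3})]`, `Λ₀ = Λ(0,0)`. -/
structure IsRegionFamily (Rf : ℝ → ℝ) : Prop where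
  pos : ∀ ε ∈ Ioo (0 : ℝ) 1, 0 < Rf ε
  lower : ∀ ε ∈ Ioo (0 : ℝ) 1, ∀ R ∈ Icc 0 (Rf ε),
    3 * d.Lam 0 0 / 4 * R ^ 2 * (1 - ε) ≤ d.yCH R ^ 3
  upper : ∀ ε ∈ Ioo (0 : ℝ) 1, ∀ R ∈ Icc 0 (Rf ε), ∀ w ∈ Icc 0 (d.yCH (Rf ε)),
    d.Lam w R ≤ (1 + ε) * d.Lam 0 0
  tendsto_R : Tendsto Rf (𝓝[>] 0) (𝓝 0)
  tendsto_y : Tendsto (fun ε => d.yCH (Rf ε)) (𝓝[>] 0) (𝓝 0)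

/-! ### Radial null geodesics and the redshift

Coordinates are `(x 0, x 1, x 2, x 3) = (τ, R, ϑ, φ)`. The radial coordinate carries a sign:
`(τ, R, ϑ, φ)` with `R < 0` is the diametrically opposed point `(τ, -R, π - ϑ, φ + π)`; a radial
geodesic that crosses the centre is then a curve along which `R` changes sign while the angles stay
constant. All metric coefficients are even in `R`. -/

/-- The spacetime metric `-dτ² + dR²/γ² + r² (dϑ² + sin²ϑ dφ²)`. -/
def metric (x : Fin 4 → ℝ) : Matrix (Fin 4) (Fin 4) ℝ :=
  Matrix.diagonal ![-1, 1 / d.γ (x 0) (x 1) ^ 2, d.r (x 0) (x 1) ^ 2,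
    d.r (x 0) (x 1) ^ 2 * Real.sin (x 2) ^ 2]

/-- The value `g(v,w)` of the metric at the point `x`. -/
def ip (x v w : Fin 4 → ℝ) : ℝ := ∑ a, ∑ b, d.metric x a b * v a * w b

/-- Four-velocity `u = ∂/∂τ` of the co-moving observers. -/
def u : Fin 4 → ℝ := ![1, 0, 0, 0]

/-- The partial derivative `∂_a g_{bc}` at the point `x`. -/
def dmetric (x : Fin 4 → ℝ) (a b c : Fin 4) : ℝ :=
  deriv (fun t => d.metric (Function.update x a t) b c) (x a)

/-- `x : [s₁,s₂] → M` is an affinely parametrized geodesic with tangent `ξ`, written in the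
covariant form `d/ds (g_{ab} ξ^b) = ½ (∂_a g_{bc}) ξ^b ξ^c`. -/
def IsGeodesic (x ξ : ℝ → Fin 4 → ℝ) (s₁ s₂ : ℝ) : Prop :=
  ∀ s ∈ Icc s₁ s₂, HasDerivWithinAt x (ξ s) (Icc s₁ s₂) s ∧
    ∀ a, HasDerivWithinAt (fun t => ∑ b, d.metric (x t) a b * ξ t b)
      (1 / 2 * ∑ b, ∑ c, d.dmetric (x s) a b c * ξ s b * ξ s c) (Icc s₁ s₂) s

/-- Future-directed, affinely parametrized radial null geodesics `[s₁,s₂] → M`. -/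
structure IsRadialNullGeodesic (x ξ : ℝ → Fin 4 → ℝ) (s₁ s₂ : ℝ) : Prop where
  geodesic : d.IsGeodesic x ξ s₁ s₂
  null : ∀ s ∈ Icc s₁ s₂, d.ip (x s) (ξ s) (ξ s) = 0
  future : ∀ s ∈ Icc s₁ s₂, d.ip (x s) u (ξ s) < 0
  radial : ∃ ϑ φ : ℝ, 0 < ϑ ∧ ϑ < Real.pi ∧
    ∀ s ∈ Icc s₁ s₂, x s 2 = ϑ ∧ x s 3 = φ ∧ ξ s 2 = 0 ∧ ξ s 3 = 0

/-- The curve `x` runs in the region `S` of the half-plane of points `(τ, R)`, `R ≥ 0`. -/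
def RunsIn (x : ℝ → Fin 4 → ℝ) (s₁ s₂ : ℝ) (S : Set (ℝ × ℝ)) : Prop :=
  ∀ s ∈ Icc s₁ s₂, (x s 0, |x s 1|) ∈ S

/-- The redshift factor `z = ν_e/ν_obs - 1 = g(u,ξ)|_e / g(u,ξ)|_obs - 1` of a signal with generator
`ξ`, emitted at the parameter `s_e` and received at `s_o` by co-moving observers. -/
def redshift (x ξ : ℝ → Fin 4 → ℝ) (s_e s_o : ℝ) : ℝ :=
  d.ip (x s_e) u (ξ s_e) / d.ip (x s_o) u (ξ s_o) - 1

end InitialData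

end TolmanBondi

end

noncomputable section

namespace TolmanBondi

/-! ### The functions `f`, `g` and `h` -/

/-! The time component of the geodesic equation, together with nullity, gives `(log ξ⁰)' = shiftRate
· |ξ¹|` along a radial null geodesic, where `shiftRate = -∂_τ(1/γ)` and `ξ¹` never vanishes
(`geodesic_equations`). Since `g(u,ξ) = -ξ⁰`, the redshift is `ξ⁰(e)/ξ⁰(obs) - 1`, and everything
reduces to the size and sign of `shiftRate` in the variables `(y, R)`. There `∂_R r = y² + R² Λ √(1
- q²y²)/y`, and differentiating this in `τ` shows that the decisive quantity is `R²/y³`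
(`shiftRate_eq`), which the Cauchy horizon controls.

For (a), a bound `y_CH³ ≥ κ R²` up to the surface gives `|shiftRate| ≤ C R^(-2/3)`, which is
integrable at the centre. As the signed radius is strictly monotone along the geodesic, the centre
is met at most once, and the logarithm of the frequency changes by a bounded amount.

For (b), near the centre the sign of `shiftRate` is that of roughly `2y³ - R² Λ₀`. Beyond the
horizon `2y³` exceeds about `(3/2) Λ₀ R²`, so the rate is positive and the frequency strictly
increases.

The lower bound on `y_CH` comes from exhibiting one ray. For `V = y³/R²` the null ray equation reads
`(R² V)' = R H(R, V)` with `H(0, ·) = 3Λ₀/2` and a Lipschitz constant in `V` that tends to `0` at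
the centre. A contraction argument yields a continuous solution with `V(0) = 3Λ₀/4`
(`exists_singular_ode_solution`, `exists_ray`). From above, the crude bound `y³ ≤ C R²` on all rays
suffices: it gives `y_CH → 0` and hence admissible choices. -/

lemma hasDerivAt_f {x : ℝ} (h1 : -1 < x) (h2 : x < 1) :
    HasDerivAt f (-(2 * x ^ 2) / √(1 - x ^ 2)) x := by
  have hp : 0 < 1 - x ^ 2 := by nlinarith
  have hs : 0 < √(1 - x ^ 2) := Real.sqrt_pos.2 hp
  have hsq : √(1 - x ^ 2) ^ 2 = 1 - x ^ 2 := Real.sq_sqrt hp.le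
  have e1 : HasDerivAt (fun x : ℝ => 1 - x ^ 2) (-(2 * x)) x := by
    simpa using ((hasDerivAt_id x).pow 2).const_sub 1
  have e2 := e1.sqrt hp.ne'
  have e3 := ((hasDerivAt_id x).mul e2).add (Real.hasDerivAt_arccos h1.ne' h2.ne)
  refine e3.congr_deriv ?_
  simp only [id]
  field_simp
  rw [hsq]; ring

lemma f_zero : f 0 = Real.pi / 2 := by simp [f]

lemma f_one : f 1 = 0 := by simp [f]

lemma continuous_f : Continuous f := by
  unfold f
  exact (continuous_id.mul (by fun_prop)).add Real.continuous_arccos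

lemma strictAntiOn_f : StrictAntiOn f (Icc 0 1) := by
  refine strictAntiOn_of_hasDerivWithinAt_neg (f' := fun x => -(2 * x ^ 2) / √(1 - x ^ 2))
    (convex_Icc 0 1) continuous_f.continuousOn ?_ ?_
  · intro x hx
    rw [interior_Icc] at hx
    exact (hasDerivAt_f (by linarith [hx.1]) hx.2).hasDerivWithinAt
  · intro x hx
    rw [interior_Icc] at hx
    have hp : 0 < 1 - x ^ 2 := by nlinarith [hx.1, hx.2]
    have hx0 := hx.1
    exact div_neg_of_neg_of_pos (neg_neg_of_pos (by positivity)) (Real.sqrt_pos.2 hp)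

lemma fInv_f {x : ℝ} (hx : x ∈ Icc (0 : ℝ) 1) : fInv (f x) = x :=
  strictAntiOn_f.injOn.leftInvOn_invFunOn hx

lemma exists_f_eq {z : ℝ} (hz : z ∈ Icc 0 (Real.pi / 2)) : ∃ x ∈ Icc (0 : ℝ) 1, f x = z := by
  have := intermediate_value_Icc' (zero_le_one' ℝ) continuous_f.continuousOn
  rw [f_zero, f_one] at this
  exact this hz

lemma f_fInv {z : ℝ} (hz : z ∈ Icc 0 (Real.pi / 2)) : f (fInv z) = z := by
  obtain ⟨x, hx, rfl⟩ := exists_f_eq hz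
  rw [fInv_f hx]

lemma fInv_mem {z : ℝ} (hz : z ∈ Ioo 0 (Real.pi / 2)) : fInv z ∈ Ioo (0 : ℝ) 1 := by
  obtain ⟨x, hx, rfl⟩ := exists_f_eq (Ioo_subset_Icc_self hz)
  rw [fInv_f hx]
  refine ⟨lt_of_le_of_ne hx.1 ?_, lt_of_le_of_ne hx.2 ?_⟩
  · rintro rfl
    exact absurd hz.2 (by rw [f_zero]; exact lt_irrefl _)
  · rintro rfl
    exact absurd hz.1 (by rw [f_one]; exact lt_irrefl _)

/-- A monotone function that maps a neighbourhood onto a neighbourhood is continuous; the sign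
change turns the decreasing inverse into an increasing one. -/
lemma continuousAt_fInv {z : ℝ} (hz : z ∈ Ioo 0 (Real.pi / 2)) : ContinuousAt fInv z := by
  have hmono : MonotoneOn (fun t => -fInv t) (Icc 0 (Real.pi / 2)) := by
    intro s hs t ht hst
    obtain ⟨x, hx, rfl⟩ := exists_f_eq hs
    obtain ⟨w, hw, rfl⟩ := exists_f_eq ht
    simp only [fInv_f hx, fInv_f hw]
    exact neg_le_neg ((strictAntiOn_f.le_iff_ge hx hw).1 hst)
  have hn : Icc 0 (Real.pi / 2) ∈ 𝓝 z := Icc_mem_nhds hz.1 hz.2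
  have him : (fun t => -fInv t) '' Icc 0 (Real.pi / 2) ∈ 𝓝 (-fInv z) := by
    have hm := fInv_mem hz
    refine mem_of_superset (Icc_mem_nhds (a := -1) (b := 0) (by linarith [hm.2])
      (by linarith [hm.1])) ?_
    intro w hw
    have hw' : -w ∈ Icc (0 : ℝ) 1 := ⟨by linarith [hw.2], by linarith [hw.1]⟩
    refine ⟨f (-w), ⟨?_, ?_⟩, ?_⟩
    · rw [← f_one]; exact (strictAntiOn_f.le_iff_ge (by simp) hw').2 hw'.2
    · rw [← f_zero]; exact (strictAntiOn_f.le_iff_ge hw' (by simp)).2 hw'.1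
    · simp [fInv_f hw']
  have : ContinuousAt (fun t => - -fInv t) z :=
    (continuousAt_of_monotoneOn_of_image_mem_nhds hmono hn him).neg
  simpa only [neg_neg] using this

lemma hasDerivAt_fInv {z : ℝ} (hz : z ∈ Ioo 0 (Real.pi / 2)) :
    HasDerivAt fInv (-√(1 - fInv z ^ 2) / (2 * fInv z ^ 2)) z := by
  have hm := fInv_mem hz
  have hx := hm.1
  have hp : 0 < √(1 - fInv z ^ 2) := Real.sqrt_pos.2 (by nlinarith [hm.1, hm.2])
  have hd := hasDerivAt_f (by linarith [hm.1]) hm.2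
  have hne : -(2 * fInv z ^ 2) / √(1 - fInv z ^ 2) ≠ 0 :=
    (div_neg_of_neg_of_pos (neg_neg_of_pos (by positivity)) hp).ne
  refine (HasDerivAt.of_local_left_inverse (continuousAt_fInv hz) hd hne ?_).congr_deriv ?_
  · filter_upwards [Icc_mem_nhds hz.1 hz.2] with t ht using f_fInv ht
  · field_simp

/-- A quantitative form of the fact that `f` attains its maximum `π/2` only at `0`. -/
lemma cube_le_sub_f {x : ℝ} (hx : x ∈ Icc (0 : ℝ) 1) :
    2 / 3 * x ^ 3 ≤ Real.pi / 2 - f x := by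
  have hd : AntitoneOn (fun x => f x + 2 / 3 * x ^ 3) (Icc 0 1) := by
    refine antitoneOn_of_hasDerivWithinAt_nonpos
      (f' := fun x => -(2 * x ^ 2) / √(1 - x ^ 2) + 2 * x ^ 2)
      (convex_Icc 0 1) (by have := continuous_f; fun_prop) ?_ ?_
    · intro x hx
      rw [interior_Icc] at hx
      have h3 : HasDerivAt (fun x : ℝ => 2 / 3 * x ^ 3) (2 * x ^ 2) x :=
        ((hasDerivAt_pow 3 x).const_mul (2 / 3)).congr_deriv (by norm_num; ring)
      exact ((hasDerivAt_f (by linarith [hx.1]) hx.2).add h3).hasDerivWithinAt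
    · intro x hx
      rw [interior_Icc] at hx
      have hp : 0 < √(1 - x ^ 2) := Real.sqrt_pos.2 (by nlinarith [hx.1, hx.2])
      have h1 : √(1 - x ^ 2) ≤ 1 := Real.sqrt_le_one.2 (by nlinarith [sq_nonneg x])
      have : 2 * x ^ 2 ≤ 2 * x ^ 2 / √(1 - x ^ 2) := by
        rw [le_div_iff₀ hp]; nlinarith [sq_nonneg x]
      rw [neg_div]; linarith
  have := hd (left_mem_Icc.2 zero_le_one) hx hx.1
  simp only [f_zero] at this
  linarith

lemma hasDerivAt_g {q y : ℝ} (hq : 0 < q) (hy : 0 ≤ y) (hqy : q * y < 1) :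
    HasDerivAt (g q) (-(2 * y ^ 2) / √(1 - q ^ 2 * y ^ 2)) y := by
  have h0 : 0 ≤ q * y := by positivity
  have h1 : HasDerivAt (fun y => q * y) q y := by
    simpa using (hasDerivAt_id y).const_mul q
  have h2 := (((hasDerivAt_f (by linarith) hqy).comp y h1).sub_const (f q)).div_const (q ^ 3)
  refine h2.congr_deriv ?_
  rw [mul_pow]
  have hp : 0 < √(1 - q ^ 2 * y ^ 2) := Real.sqrt_pos.2 (by nlinarith)
  field_simp

lemma hasDerivAt_sqrt_one_sub {q y : ℝ} (hq : 0 < q) (hy : 0 ≤ y) (hqy : q * y < 1) :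
    HasDerivAt (fun y => √(1 - q ^ 2 * y ^ 2)) (-(q ^ 2 * y) / √(1 - q ^ 2 * y ^ 2)) y := by
  have h0 : 0 ≤ q * y := by positivity
  have hp : 0 < 1 - q ^ 2 * y ^ 2 := by nlinarith
  have e1 : HasDerivAt (fun y : ℝ => 1 - q ^ 2 * y ^ 2) (-(q ^ 2 * (2 * y))) y := by
    simpa using ((hasDerivAt_pow 2 y).const_mul (q ^ 2)).const_sub 1
  refine (e1.sqrt hp.ne').congr_deriv ?_
  have := Real.sqrt_pos.2 hp
  field_simp

/-- The weight `3/2` of `g` in `h` cancels the `y²` terms, so the remaining derivative has one sign.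
-/
lemma hasDerivAt_h {q y : ℝ} (hq : 0 < q) (hy : 0 ≤ y) (hqy : q * y < 1) :
    HasDerivAt (h q) (-(q ^ 2 * y ^ 4) / √(1 - q ^ 2 * y ^ 2) ^ 3) y := by
  have h0 : 0 ≤ q * y := by positivity
  have hp : 0 < 1 - q ^ 2 * y ^ 2 := by nlinarith
  have hs := Real.sqrt_pos.2 hp
  have h1 := (((hasDerivAt_pow 3 y).div (hasDerivAt_sqrt_one_sub hq hy hqy) hs.ne').const_sub
    (1 / √(1 - q ^ 2))).sub ((hasDerivAt_g hq hy hqy).const_mul (3 / 2))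
  refine h1.congr_deriv ?_
  have hsq := Real.sq_sqrt hp.le
  push_cast
  field_simp
  ring

lemma antitoneOn_g {q : ℝ} (hq : 0 < q) (hq1 : q < 1) : AntitoneOn (g q) (Icc 0 1) := by
  have hk : ∀ y ∈ Icc (0 : ℝ) 1, q * y < 1 := fun y hy => by nlinarith [hy.1, hy.2]
  refine antitoneOn_of_hasDerivWithinAt_nonpos (convex_Icc 0 1)
    (fun y hy => (hasDerivAt_g hq hy.1 (hk y hy)).continuousAt.continuousWithinAt)
    (fun y hy => (hasDerivAt_g hq (interior_subset hy).1
      (hk y (interior_subset hy))).hasDerivWithinAt) ?_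
  intro y _
  exact div_nonpos_of_nonpos_of_nonneg (neg_nonpos.2 (by positivity)) (Real.sqrt_nonneg _)

lemma strictAntiOn_h {q : ℝ} (hq : 0 < q) (hq1 : q < 1) : StrictAntiOn (h q) (Icc 0 1) := by
  have hk : ∀ y ∈ Icc (0 : ℝ) 1, q * y < 1 := fun y hy => by nlinarith [hy.1, hy.2]
  refine strictAntiOn_of_hasDerivWithinAt_neg (convex_Icc 0 1)
    (fun y hy => (hasDerivAt_h hq hy.1 (hk y hy)).continuousAt.continuousWithinAt)
    (fun y hy => (hasDerivAt_h hq (interior_subset hy).1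
      (hk y (interior_subset hy))).hasDerivWithinAt) ?_
  intro y hy
  have hy' := interior_subset hy
  rw [interior_Icc] at hy
  have h0 := hy.1
  have := hk y hy'
  have h0 : 0 < q * y := by positivity
  have hp : 0 < √(1 - q ^ 2 * y ^ 2) := Real.sqrt_pos.2 (by nlinarith)
  exact div_neg_of_neg_of_pos (neg_neg_of_pos (by positivity)) (by positivity)

lemma g_one (q : ℝ) : g q 1 = 0 := by simp [g]

lemma h_one (q : ℝ) : h q 1 = 0 := by simp [h, g_one]

lemma g_nonneg {q y : ℝ} (hq : 0 < q) (hq1 : q < 1) (hy : y ∈ Icc (0 : ℝ) 1) : 0 ≤ g q y := by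
  rw [← g_one q]; exact antitoneOn_g hq hq1 hy (by simp) hy.2

lemma h_nonneg {q y : ℝ} (hq : 0 < q) (hq1 : q < 1) (hy : y ∈ Icc (0 : ℝ) 1) : 0 ≤ h q y := by
  rw [← h_one q]; exact (strictAntiOn_h hq hq1).antitoneOn hy (by simp) hy.2

lemma h_zero_pos {q : ℝ} (hq : 0 < q) (hq1 : q < 1) : 0 < h q 0 := by
  have := strictAntiOn_h hq hq1 (a := 0) (b := 1) (by simp) (by simp) zero_lt_one
  rwa [h_one] at this

lemma g_zero_pos {q : ℝ} (hq : 0 < q) (hq1 : q < 1) : 0 < g q 0 := by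
  unfold g
  have := strictAntiOn_f (a := 0) (b := q) (by simp) ⟨hq.le, hq1.le⟩ hq
  rw [mul_zero]
  exact div_pos (by linarith) (by positivity)

/-! ### Division of an odd function by its argument -/

lemma divR_mul (φ : ℝ → ℝ) (h0 : φ 0 = 0) (R : ℝ) : φ R = R * divR φ R := by
  unfold divR
  split_ifs with hR
  · rw [hR, h0]; simp
  · field_simp

lemma divR_neg {φ : ℝ → ℝ} (hodd : ∀ R, φ (-R) = -φ R) (R : ℝ) : divR φ (-R) = divR φ R := by
  unfold divR
  rw [hodd]
  simp

lemma continuous_divR {φ : ℝ → ℝ} (hd : Differentiable ℝ φ) (h0 : φ 0 = 0) :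
    Continuous (divR φ) := by
  have : divR φ = dslope φ 0 := by
    ext R
    by_cases hR : R = 0
    · simp [divR, hR]
    · simp [divR, hR, dslope_of_ne, slope_def_field, h0]
  rw [this, continuous_iff_continuousAt]
  intro R
  by_cases hR : R = 0
  · rw [hR, continuousAt_dslope_same]; exact hd 0
  · rw [continuousAt_dslope_of_ne hR]; exact (hd R).continuousAt

lemma deriv_odd_of_even {φ : ℝ → ℝ} (he : ∀ R, φ (-R) = φ R) (R : ℝ) :
    deriv φ (-R) = -deriv φ R := by
  have h1 : deriv (fun R => φ (-R)) R = deriv φ R := by simp only [he]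
  rw [deriv_comp_neg] at h1
  linarith

/-! ### Moments along rays through the origin -/

lemma hasDerivAt_moment {F : ℝ → ℝ} (hF : ContDiff ℝ ∞ F) (k : ℕ) (R : ℝ) :
    HasDerivAt (fun R => ∫ t in (0 : ℝ)..1, F (R * t) * t ^ k)
      (∫ t in (0 : ℝ)..1, deriv F (R * t) * t ^ (k + 1)) R := by
  have hd : Differentiable ℝ F := hF.differentiable (by simp)
  have hc : Continuous F := hF.continuous
  have hc' : Continuous (deriv F) := hF.continuous_deriv (by simp)
  obtain ⟨M, hM⟩ := (isCompact_Icc (a := -(|R| + 1)) (b := |R| + 1)).exists_bound_of_continuousOn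
    hc'.continuousOn
  refine (intervalIntegral.hasDerivAt_integral_of_dominated_loc_of_deriv_le
    (F' := fun R t => deriv F (R * t) * t ^ (k + 1)) (bound := fun _ => M)
    (Metric.ball_mem_nhds R zero_lt_one) (Eventually.of_forall fun x => ?_) ?_ ?_ ?_ ?_ ?_).2
  · exact Continuous.aestronglyMeasurable (by fun_prop)
  · exact Continuous.intervalIntegrable (by fun_prop) _ _
  · exact Continuous.aestronglyMeasurable (by fun_prop)
  · refine Eventually.of_forall fun t ht x hx => ?_
    rw [uIoc_of_le zero_le_one] at ht
    have hx' : |x| ≤ |R| + 1 := by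
      rw [Metric.mem_ball, Real.dist_eq] at hx
      have := abs_sub_abs_le_abs_sub x R
      linarith
    have hxt : |x * t| ≤ |R| + 1 := by
      rw [abs_mul, abs_of_pos ht.1]
      nlinarith [abs_nonneg x, ht.1, ht.2]
    have hb := hM (x * t) (abs_le.1 hxt)
    rw [norm_mul, norm_pow, Real.norm_of_nonneg ht.1.le]
    have : t ^ (k + 1) ≤ 1 := pow_le_one₀ ht.1.le ht.2
    have h0 := norm_nonneg (deriv F (x * t))
    have : 0 ≤ t ^ (k + 1) := pow_nonneg ht.1.le _
    nlinarith
  · exact intervalIntegrable_const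
  · refine Eventually.of_forall fun t _ x _ => ?_
    have h1 : HasDerivAt (fun x => x * t) t x := by
      simpa using (hasDerivAt_id x).mul_const t
    refine (((hd (x * t)).hasDerivAt.comp x h1).mul_const (t ^ k)).congr_deriv ?_
    ring

/-- Differentiation replaces `(F, k)` by `(F', k + 1)`, so the family of moments is closed under it
and the induction runs over all `F` and `k` at once. -/
lemma contDiff_moment (n : ℕ) : ∀ {F : ℝ → ℝ}, ContDiff ℝ ∞ F → ∀ k : ℕ,
    ContDiff ℝ n (fun R => ∫ t in (0 : ℝ)..1, F (R * t) * t ^ k) := by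
  induction n with
  | zero =>
    intro F hF k
    exact contDiff_zero.2 (continuous_iff_continuousAt.2
      fun R => (hasDerivAt_moment hF k R).continuousAt)
  | succ n ih =>
    intro F hF k
    push_cast
    refine contDiff_succ_iff_deriv.2 ⟨fun R => (hasDerivAt_moment hF k R).differentiableAt,
      by simp, ?_⟩
    rw [show deriv (fun R => ∫ t in (0 : ℝ)..1, F (R * t) * t ^ k) =
      fun R => ∫ t in (0 : ℝ)..1, deriv F (R * t) * t ^ (k + 1) from
      funext fun R => (hasDerivAt_moment hF k R).deriv]
    exact ih (contDiff_infty_iff_deriv.1 hF).2 (k + 1)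

/-- The fundamental theorem of calculus on `[0, R]`, rescaled to `[0, 1]`. It turns a quotient that
is singular in appearance into a smooth function of `R`. -/
lemma divR_eq_moment {φ : ℝ → ℝ} (hφ : ContDiff ℝ ∞ φ) (h0 : φ 0 = 0) (R : ℝ) :
    divR φ R = ∫ t in (0 : ℝ)..1, deriv φ (R * t) * t ^ 0 := by
  unfold divR
  split_ifs with hR
  · simp [hR]
  · have hd : Differentiable ℝ φ := hφ.differentiable (by simp)
    have hc' : Continuous (deriv φ) := hφ.continuous_deriv (by simp)
    have h1 := intervalIntegral.mul_integral_comp_mul_left (a := 0) (b := 1) (f := deriv φ) R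
    rw [intervalIntegral.integral_deriv_eq_sub (fun x _ => hd x) (hc'.intervalIntegrable _ _)] at h1
    simp only [mul_zero, mul_one, h0, sub_zero] at h1
    rw [← h1]
    simp only [pow_zero, mul_one]
    field_simp

lemma contDiff_divR {φ : ℝ → ℝ} (hφ : ContDiff ℝ ∞ φ) (h0 : φ 0 = 0) (n : ℕ) :
    ContDiff ℝ n (divR φ) := by
  rw [show divR φ = fun R => ∫ t in (0 : ℝ)..1, deriv φ (R * t) * t ^ 0 from
    funext (divR_eq_moment hφ h0)]
  exact contDiff_moment n (contDiff_infty_iff_deriv.1 hφ).2 0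

/-! ### The coefficients of `Λ` and the energy factor -/

namespace InitialData

variable {d : InitialData}

/-- The coefficient of `h` in `Λ`. -/
def hCoeff (d : InitialData) (R : ℝ) : ℝ := 2 * (divR (deriv d.q) R / d.q R)

/-- The coefficient of `-g` in `Λ`. -/
def gCoeff (d : InitialData) (R : ℝ) : ℝ := divR (deriv d.c) R / (2 * d.c R)

/-- The energy factor `√(1 + 2E)`. -/
def energy (d : InitialData) (R : ℝ) : ℝ := √(1 + 2 * d.E R)

/-- `√(1 - q² y²)`. -/
def root (d : InitialData) (y R : ℝ) : ℝ := √(1 - d.q R ^ 2 * y ^ 2)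

/-- `∂Λ/∂y`. -/
def dLam (d : InitialData) (y R : ℝ) : ℝ :=
  -(d.hCoeff R * (d.q R ^ 2 * y ^ 4) / d.root y R ^ 3) + 2 * d.gCoeff R * y ^ 2 / d.root y R

lemma Lam_eq (d : InitialData) (y R : ℝ) :
    d.Lam y R = d.hCoeff R * h (d.q R) y - d.gCoeff R * g (d.q R) y := rfl

/-! ### Regularity and parity of the profile functions -/

lemma m_eq (d : InitialData) (R : ℝ) :
    d.m R = 4 * Real.pi * d.G * (R ^ 3 * ∫ t in (0 : ℝ)..1, d.ρ₀ (R * t) * t ^ 2) := by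
  have h1 := intervalIntegral.mul_integral_comp_mul_left (a := 0) (b := 1)
    (f := fun s => d.ρ₀ s * s ^ 2) R
  have h2 : (∫ t in (0 : ℝ)..1, d.ρ₀ (R * t) * (R * t) ^ 2) =
      R ^ 2 * ∫ t in (0 : ℝ)..1, d.ρ₀ (R * t) * t ^ 2 := by
    rw [← intervalIntegral.integral_const_mul]
    exact intervalIntegral.integral_congr fun t _ => by ring
  rw [h2, mul_zero, mul_one] at h1
  unfold m
  rw [← h1]
  ring

/-- The substitution `s = Rt` absorbs the factor `R³` and merges both branches of the definition
into one formula, from which smoothness and evenness can be read off. -/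
lemma c_eq (d : InitialData) (R : ℝ) :
    d.c R = 8 * Real.pi * d.G * ∫ t in (0 : ℝ)..1, d.ρ₀ (R * t) * t ^ 2 := by
  unfold c
  split_ifs with hR
  · simp [hR]; ring
  · rw [m_eq]; field_simp; ring

lemma two_m_eq (d : InitialData) (R : ℝ) : 2 * d.m R = d.c R * R ^ 3 := by
  rw [m_eq, c_eq]; ring

lemma E_eq (d : InitialData) (R : ℝ) : d.E R = d.v₀ R ^ 2 / 2 - d.c R * R ^ 2 / 2 := by
  unfold E
  rw [show d.m R = d.c R * R ^ 3 / 2 by linarith [d.two_m_eq R]]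
  by_cases hR : R = 0
  · simp [hR]
  · field_simp

lemma root_pos_of {y R : ℝ} (h0 : 0 ≤ d.q R * y) (h1 : d.q R * y < 1) : 0 < d.root y R :=
  Real.sqrt_pos.2 (by nlinarith)

lemma root_le_one {y R : ℝ} : d.root y R ≤ 1 :=
  Real.sqrt_le_one.2 (by nlinarith [sq_nonneg (d.q R * y)])

section

variable (hd : d.Admissible)
include hd

lemma Admissible.contDiff_c (n : ℕ) : ContDiff ℝ n d.c := by
  rw [show d.c = fun R => 8 * Real.pi * d.G * ∫ t in (0 : ℝ)..1, d.ρ₀ (R * t) * t ^ 2 from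
    funext d.c_eq]
  exact contDiff_const.mul (contDiff_moment n hd.smooth_ρ₀ 2)

lemma Admissible.v_zero : d.v₀ 0 = 0 := by
  have := hd.odd_v₀ 0
  rw [neg_zero] at this
  linarith

lemma Admissible.c_neg (R : ℝ) : d.c (-R) = d.c R := by
  rw [c_eq, c_eq]
  simp only [neg_mul, hd.even_ρ₀]

lemma Admissible.q_neg (R : ℝ) : d.q (-R) = d.q R := by
  unfold q
  rw [hd.c_neg, divR_neg hd.odd_v₀]

lemma Admissible.E_neg (R : ℝ) : d.E (-R) = d.E R := by
  rw [E_eq, E_eq, hd.c_neg, hd.odd_v₀]; ring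

lemma Admissible.c_pos (R : ℝ) : 0 < d.c R := by
  have key : ∀ R, 0 ≤ R → 0 < d.c R := fun R hR => (sq_nonneg _).trans_lt (hd.bounded R hR)
  rcases le_total 0 R with hR | hR
  · exact key R hR
  · rw [← hd.c_neg]; exact key _ (by linarith)

/-- Bounded collapse keeps the radicand positive and strict infall keeps it below `1`, so `q` is
smooth with values in `(0, 1)`. Evenness carries this to `R < 0`, where geodesics through the centre
also run. -/
lemma Admissible.q_arg_mem (R : ℝ) : 1 - divR d.v₀ R ^ 2 / d.c R ∈ Ioo (0 : ℝ) 1 := by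
  have key : ∀ R, 0 ≤ R → 1 - divR d.v₀ R ^ 2 / d.c R ∈ Ioo (0 : ℝ) 1 := by
    intro R hR
    have hc := hd.c_pos R
    have h1 : divR d.v₀ R ^ 2 / d.c R < 1 := (div_lt_one hc).2 (hd.bounded R hR)
    have h2 : 0 < divR d.v₀ R ^ 2 / d.c R := by
      have := (hd.collapsing R hR).ne
      positivity
    exact ⟨by linarith, by linarith⟩
  rcases le_total 0 R with hR | hR
  · exact key R hR
  · rw [← hd.c_neg, ← divR_neg hd.odd_v₀]; exact key _ (by linarith)

lemma Admissible.q_pos (R : ℝ) : 0 < d.q R := Real.sqrt_pos.2 (hd.q_arg_mem R).1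

lemma Admissible.q_lt_one (R : ℝ) : d.q R < 1 := by
  have h1 := hd.q_arg_mem R
  unfold q
  rw [Real.sqrt_lt' one_pos]
  linarith [h1.2]

lemma Admissible.contDiff_q (n : ℕ) : ContDiff ℝ n d.q := by
  unfold q
  refine ContDiff.sqrt (contDiff_const.sub (((contDiff_divR hd.smooth_v₀ hd.v_zero n).pow 2).div
    (hd.contDiff_c n) fun R => (hd.c_pos R).ne')) fun R => (hd.q_arg_mem R).1.ne'

lemma Admissible.differentiable_c : Differentiable ℝ d.c :=
  (hd.contDiff_c 1).differentiable (by simp)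

lemma Admissible.differentiable_q : Differentiable ℝ d.q :=
  (hd.contDiff_q 1).differentiable (by simp)

lemma Admissible.differentiable_deriv_c : Differentiable ℝ (deriv d.c) := by
  have h2 : ContDiff ℝ (1 + 1) d.c := by
    have := hd.contDiff_c (1 + 1)
    exact_mod_cast this
  exact (contDiff_succ_iff_deriv.1 h2).2.2.differentiable (by simp)

lemma Admissible.differentiable_deriv_q : Differentiable ℝ (deriv d.q) := by
  have h2 : ContDiff ℝ (1 + 1) d.q := by
    have := hd.contDiff_q (1 + 1)
    exact_mod_cast this
  exact (contDiff_succ_iff_deriv.1 h2).2.2.differentiable (by simp)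

lemma Admissible.continuous_c : Continuous d.c := hd.differentiable_c.continuous

lemma Admissible.continuous_q : Continuous d.q := hd.differentiable_q.continuous

lemma Admissible.deriv_c_zero : deriv d.c 0 = 0 := by
  have := deriv_odd_of_even hd.c_neg 0
  rw [neg_zero] at this
  linarith

lemma Admissible.deriv_q_zero : deriv d.q 0 = 0 := by
  have := deriv_odd_of_even hd.q_neg 0
  rw [neg_zero] at this
  linarith

lemma Admissible.continuous_divR_deriv_c : Continuous (divR (deriv d.c)) :=
  continuous_divR hd.differentiable_deriv_c hd.deriv_c_zero

lemma Admissible.continuous_divR_deriv_q : Continuous (divR (deriv d.q)) :=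
  continuous_divR hd.differentiable_deriv_q hd.deriv_q_zero

lemma Admissible.continuous_hCoeff : Continuous d.hCoeff :=
  continuous_const.mul (hd.continuous_divR_deriv_q.div hd.continuous_q fun R => (hd.q_pos R).ne')

lemma Admissible.continuous_gCoeff : Continuous d.gCoeff :=
  hd.continuous_divR_deriv_c.div (continuous_const.mul hd.continuous_c)
    fun R => (mul_pos two_pos (hd.c_pos R)).ne'

lemma Admissible.divR_deriv_c_neg (R : ℝ) : divR (deriv d.c) (-R) = divR (deriv d.c) R :=
  divR_neg (deriv_odd_of_even hd.c_neg) R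

lemma Admissible.divR_deriv_q_neg (R : ℝ) : divR (deriv d.q) (-R) = divR (deriv d.q) R :=
  divR_neg (deriv_odd_of_even hd.q_neg) R

lemma Admissible.Lam_neg (y R : ℝ) : d.Lam y (-R) = d.Lam y R := by
  unfold Lam
  rw [hd.divR_deriv_c_neg, hd.divR_deriv_q_neg, hd.c_neg, hd.q_neg]

lemma Admissible.dLam_neg (y R : ℝ) : d.dLam y (-R) = d.dLam y R := by
  unfold dLam hCoeff gCoeff root
  rw [hd.divR_deriv_c_neg, hd.divR_deriv_q_neg, hd.c_neg, hd.q_neg]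

lemma Admissible.energy_neg (R : ℝ) : d.energy (-R) = d.energy R := by
  unfold energy
  rw [hd.E_neg]

/-- The sign is assumed only for `R > 0`; at the centre it passes to the limit. -/
lemma Admissible.divR_deriv_c_nonpos {R : ℝ} (hR : 0 ≤ R) : divR (deriv d.c) R ≤ 0 := by
  have key : ∀ R, 0 < R → divR (deriv d.c) R ≤ 0 := by
    intro R hR
    rw [divR, if_neg hR.ne']
    exact div_nonpos_of_nonpos_of_nonneg (hd.c_mono R hR) hR.le
  rcases hR.eq_or_lt with rfl | hR
  · exact le_of_tendsto (hd.continuous_divR_deriv_c.continuousWithinAt (s := Ioi 0) (x := 0))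
      (eventually_mem_nhdsWithin.mono key)
  · exact key R hR

lemma Admissible.divR_deriv_q_nonneg {R : ℝ} (hR : 0 ≤ R) : 0 ≤ divR (deriv d.q) R := by
  have key : ∀ R, 0 < R → 0 ≤ divR (deriv d.q) R := by
    intro R hR
    rw [divR, if_neg hR.ne']
    exact div_nonneg (hd.q_mono R hR) hR.le
  rcases hR.eq_or_lt with rfl | hR
  · exact ge_of_tendsto (hd.continuous_divR_deriv_q.continuousWithinAt (s := Ioi 0) (x := 0))
      (eventually_mem_nhdsWithin.mono key)
  · exact key R hR

lemma Admissible.hCoeff_nonneg {R : ℝ} (hR : 0 ≤ R) : 0 ≤ d.hCoeff R :=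
  mul_nonneg two_pos.le (div_nonneg (hd.divR_deriv_q_nonneg hR) (hd.q_pos R).le)

lemma Admissible.gCoeff_nonpos {R : ℝ} (hR : 0 ≤ R) : d.gCoeff R ≤ 0 :=
  div_nonpos_of_nonpos_of_nonneg (hd.divR_deriv_c_nonpos hR) (by have := hd.c_pos R; positivity)

/-- For `R > 0` this is `1 - 2m/R + v₀²`, positive because the initial slice is untrapped. -/
lemma Admissible.one_add_E_pos (R : ℝ) : 0 < 1 + 2 * d.E R := by
  have key : ∀ R, 0 ≤ R → 0 < 1 + 2 * d.E R := by
    intro R hR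
    rw [E_eq]
    rcases hR.eq_or_lt with rfl | hR
    · simp [hd.v_zero]
    · have h1 := hd.untrapped R hR
      rw [two_m_eq, show d.c R * R ^ 3 / R = d.c R * R ^ 2 by field_simp] at h1
      nlinarith [sq_nonneg (d.v₀ R)]
  rcases le_total 0 R with hR | hR
  · exact key R hR
  · rw [← hd.E_neg]; exact key _ (by linarith)

lemma Admissible.energy_pos (R : ℝ) : 0 < d.energy R := Real.sqrt_pos.2 (hd.one_add_E_pos R)

lemma Admissible.continuous_energy : Continuous d.energy := by
  unfold energy
  rw [show d.E = fun R => d.v₀ R ^ 2 / 2 - d.c R * R ^ 2 / 2 from funext d.E_eq]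
  have := hd.smooth_v₀.continuous
  have := hd.continuous_c
  fun_prop

lemma Admissible.q_mul_lt_one {y R : ℝ} (hy : y ∈ Icc (0 : ℝ) 1) : d.q R * y < 1 := by
  nlinarith [hd.q_pos R, hd.q_lt_one R, hy.1, hy.2]

lemma Admissible.root_pos {y R : ℝ} (hy : y ∈ Icc (0 : ℝ) 1) : 0 < d.root y R :=
  root_pos_of (mul_nonneg (hd.q_pos R).le hy.1) (hd.q_mul_lt_one hy)

lemma Admissible.hasDerivAt_root {y R : ℝ} (hy : 0 ≤ y) (hqy : d.q R * y < 1) :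
    HasDerivAt (fun y => d.root y R) (-(d.q R ^ 2 * y) / d.root y R) y :=
  hasDerivAt_sqrt_one_sub (hd.q_pos R) hy hqy

lemma Admissible.hasDerivAt_Lam {y R : ℝ} (hy : 0 ≤ y) (hqy : d.q R * y < 1) :
    HasDerivAt (fun y => d.Lam y R) (d.dLam y R) y := by
  refine (((hasDerivAt_h (hd.q_pos R) hy hqy).const_mul (d.hCoeff R)).sub
    ((hasDerivAt_g (hd.q_pos R) hy hqy).const_mul (d.gCoeff R))).congr_deriv ?_
  unfold dLam root
  ring

lemma Admissible.Lam_nonneg {y R : ℝ} (hR : 0 ≤ R) (hy : y ∈ Icc (0 : ℝ) 1) : 0 ≤ d.Lam y R := by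
  rw [Lam_eq]
  have h1 := mul_nonneg (hd.hCoeff_nonneg hR) (h_nonneg (hd.q_pos R) (hd.q_lt_one R) hy)
  have h2 := mul_nonneg (neg_nonneg.2 (hd.gCoeff_nonpos hR))
    (g_nonneg (hd.q_pos R) (hd.q_lt_one R) hy)
  linarith

/-- Both contributions are nonnegative, `g(q,0)` and `h(q,0)` are positive, and non-degeneracy at
the centre prevents both coefficients from vanishing there. -/
lemma Admissible.Lam_zero_pos : 0 < d.Lam 0 0 := by
  have hh := h_zero_pos (hd.q_pos 0) (hd.q_lt_one 0)
  have hg := g_zero_pos (hd.q_pos 0) (hd.q_lt_one 0)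
  have hq := hd.q_pos 0
  have hc := hd.c_pos 0
  rw [Lam_eq]
  have ha := hd.hCoeff_nonneg le_rfl
  have hb := hd.gCoeff_nonpos le_rfl
  rcases (hd.divR_deriv_c_nonpos le_rfl).eq_or_lt with h0 | h0
  · have h1 := hd.nondegenerate 0 le_rfl h0
    have : 0 < d.hCoeff 0 := by unfold hCoeff; positivity
    nlinarith
  · have : d.gCoeff 0 < 0 := div_neg_of_neg_of_pos h0 (by positivity)
    nlinarith

/-! ### Joint continuity in `(y, R)` -/

lemma Admissible.continuous_g : Continuous fun p : ℝ × ℝ => g (d.q p.2) p.1 := by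
  unfold g
  have := continuous_f
  have := hd.continuous_q
  refine Continuous.div (by fun_prop) (by fun_prop) fun p => (pow_pos (hd.q_pos p.2) 3).ne'

lemma Admissible.continuous_root : Continuous fun p : ℝ × ℝ => d.root p.1 p.2 := by
  unfold root
  have := hd.continuous_q
  fun_prop

lemma Admissible.continuousOn_h :
    ContinuousOn (fun p : ℝ × ℝ => h (d.q p.2) p.1) (Icc 0 1 ×ˢ univ) := by
  unfold h
  have h1 := hd.continuous_q
  have hr := hd.continuous_root
  have hg := hd.continuous_g
  unfold root at hr
  refine ContinuousOn.sub (ContinuousOn.sub ?_ ?_)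
    (continuous_const.mul hg).continuousOn
  · refine ContinuousOn.div (by fun_prop) (by fun_prop) fun p _ => (Real.sqrt_pos.2 ?_).ne'
    nlinarith [hd.q_pos p.2, hd.q_lt_one p.2]
  · exact ContinuousOn.div (by fun_prop) (by fun_prop) fun p hp => (hd.root_pos hp.1).ne'

lemma Admissible.continuousOn_Lam :
    ContinuousOn (fun p : ℝ × ℝ => d.Lam p.1 p.2) (Icc 0 1 ×ˢ univ) :=
  ((hd.continuous_hCoeff.comp continuous_snd).continuousOn.mul hd.continuousOn_h).sub
    ((hd.continuous_gCoeff.comp continuous_snd).mul hd.continuous_g).continuousOn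

lemma Admissible.continuousOn_dLam :
    ContinuousOn (fun p : ℝ × ℝ => d.dLam p.1 p.2) (Icc 0 1 ×ˢ univ) := by
  unfold dLam
  have h1 := hd.continuous_q
  have h2 := hd.continuous_root
  have h3 := hd.continuous_hCoeff
  have h4 := hd.continuous_gCoeff
  refine ContinuousOn.add (ContinuousOn.neg (ContinuousOn.div (by fun_prop) (by fun_prop) ?_))
    (ContinuousOn.div (by fun_prop) (by fun_prop) ?_)
  · exact fun p hp => (pow_pos (hd.root_pos hp.1) 3).ne'
  · exact fun p hp => (hd.root_pos hp.1).ne'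

end

/-! ### Derivatives of `y`, `r` and `1/γ` -/

/-- The argument of `f⁻¹` in the definition of `y`. -/
def phase (d : InitialData) (τ R : ℝ) : ℝ := f (d.q R) + √(d.c R) * d.q R ^ 3 * τ

/-- `∂r/∂R` as a function of `(y, R)`. -/
def stretch (d : InitialData) (y R : ℝ) : ℝ := y ^ 2 + R ^ 2 * d.Lam y R * d.root y R / y

/-- The partial derivative of `stretch` with respect to `y`. -/
def dStretch (d : InitialData) (y R : ℝ) : ℝ :=
  2 * y - R ^ 2 * d.Lam y R / (y ^ 2 * d.root y R) + R ^ 2 * d.dLam y R * d.root y R / y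

/-- The rate of decrease `-∂y/∂τ` as a function of `(y, R)`. -/
def speed (d : InitialData) (y R : ℝ) : ℝ := √(d.c R) * d.root y R / (2 * y ^ 2)

lemma y_eq (d : InitialData) (τ R : ℝ) : d.y τ R = fInv (d.phase τ R) / d.q R := rfl

lemma Admissible.sqrt_c_pos (hd : d.Admissible) (R : ℝ) : 0 < √(d.c R) :=
  Real.sqrt_pos.2 (hd.c_pos R)

lemma Admissible.f_q_pos (hd : d.Admissible) (R : ℝ) : 0 < f (d.q R) := by
  have := strictAntiOn_f (a := d.q R) (b := 1) ⟨(hd.q_pos R).le, (hd.q_lt_one R).le⟩ (by simp)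
    (hd.q_lt_one R)
  rwa [f_one] at this

lemma Admissible.phase_mem (hd : d.Admissible) {τ R : ℝ} (h0 : 0 ≤ τ) (h1 : τ < d.τs R) :
    d.phase τ R ∈ Ioo 0 (Real.pi / 2) := by
  have hk : 0 < √(d.c R) * d.q R ^ 3 := mul_pos (hd.sqrt_c_pos R) (pow_pos (hd.q_pos R) 3)
  have := hd.f_q_pos R
  unfold phase
  refine ⟨by positivity, ?_⟩
  rw [τs, lt_div_iff₀ hk] at h1
  linarith

section

variable {τ R : ℝ}

lemma Admissible.q_mul_y (hd : d.Admissible) : d.q R * d.y τ R = fInv (d.phase τ R) := by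
  rw [y_eq, mul_div_cancel₀ _ (hd.q_pos R).ne']

lemma Admissible.q_mul_y_mem (hd : d.Admissible) (hp : d.phase τ R ∈ Ioo 0 (Real.pi / 2)) :
    d.q R * d.y τ R ∈ Ioo (0 : ℝ) 1 := by
  rw [hd.q_mul_y]; exact fInv_mem hp

lemma Admissible.y_pos (hd : d.Admissible) (hp : d.phase τ R ∈ Ioo 0 (Real.pi / 2)) :
    0 < d.y τ R :=
  (mul_pos_iff_of_pos_left (hd.q_pos R)).1 (hd.q_mul_y_mem hp).1

lemma Admissible.f_q_mul_y (hd : d.Admissible) (hp : d.phase τ R ∈ Ioo 0 (Real.pi / 2)) :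
    f (d.q R * d.y τ R) = d.phase τ R := by
  rw [hd.q_mul_y, f_fInv (Ioo_subset_Icc_self hp)]

/-- The inversion of `f` in the definition of `y` is undone; this identity eliminates `τ` in favour
of `y` later on. -/
lemma Admissible.g_y (hd : d.Admissible) (hp : d.phase τ R ∈ Ioo 0 (Real.pi / 2)) :
    g (d.q R) (d.y τ R) = √(d.c R) * τ := by
  have := hd.q_pos R
  rw [g, hd.f_q_mul_y hp, phase]
  field_simp
  ring

lemma Admissible.y_le_one (hd : d.Admissible) (h0 : 0 ≤ τ) (h1 : τ < d.τs R) :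
    d.y τ R ≤ 1 := by
  have hp := hd.phase_mem h0 h1
  have hm := hd.q_mul_y_mem hp
  by_contra! hlt
  have hq := hd.q_pos R
  have h2 := strictAntiOn_f (a := d.q R) (b := d.q R * d.y τ R) ⟨hq.le, (hd.q_lt_one R).le⟩
    ⟨hm.1.le, hm.2.le⟩ (by nlinarith)
  rw [hd.f_q_mul_y hp, phase] at h2
  have : 0 ≤ √(d.c R) * d.q R ^ 3 * τ := by positivity
  linarith

lemma Admissible.y_mem (hd : d.Admissible) (h0 : 0 ≤ τ) (h1 : τ < d.τs R) :
    d.y τ R ∈ Ioc (0 : ℝ) 1 :=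
  ⟨hd.y_pos (hd.phase_mem h0 h1), hd.y_le_one h0 h1⟩

lemma Admissible.root_y_pos (hd : d.Admissible) (hp : d.phase τ R ∈ Ioo 0 (Real.pi / 2)) :
    0 < d.root (d.y τ R) R :=
  root_pos_of (hd.q_mul_y_mem hp).1.le (hd.q_mul_y_mem hp).2

/-- The derivative of `y` along a curve `τ = T(R)`. -/
lemma Admissible.hasDerivWithinAt_y (hd : d.Admissible) {T : ℝ → ℝ} {T' : ℝ} {s : Set ℝ}
    (hp : d.phase (T R) R ∈ Ioo 0 (Real.pi / 2)) (hT : HasDerivWithinAt T T' s R) :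
    HasDerivWithinAt (fun x => d.y (T x) x)
      (R * d.Lam (d.y (T R) R) R * d.root (d.y (T R) R) R / (2 * d.y (T R) R ^ 2)
        - d.speed (d.y (T R) R) R * T') s R := by
  have hq := hd.q_pos R
  have hq1 := hd.q_lt_one R
  have hc := hd.c_pos R
  have hqd : HasDerivWithinAt d.q (R * divR (deriv d.q) R) s R := by
    rw [← divR_mul _ hd.deriv_q_zero]; exact (hd.differentiable_q R).hasDerivAt.hasDerivWithinAt
  have hcd : HasDerivWithinAt d.c (R * divR (deriv d.c) R) s R := by
    rw [← divR_mul _ hd.deriv_c_zero]; exact (hd.differentiable_c R).hasDerivAt.hasDerivWithinAt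
  have h1 : HasDerivWithinAt (fun x => d.phase (T x) x)
      (-(2 * d.q R ^ 2) / √(1 - d.q R ^ 2) * (R * divR (deriv d.q) R)
        + ((R * divR (deriv d.c) R / (2 * √(d.c R)) * d.q R ^ 3
          + √(d.c R) * (3 * d.q R ^ 2 * (R * divR (deriv d.q) R))) * T R
          + √(d.c R) * d.q R ^ 3 * T')) s R :=
    ((hasDerivAt_f (by linarith) hq1).comp_hasDerivWithinAt R hqd).add
      (((hcd.sqrt hc.ne').mul (hqd.pow 3)).mul hT)
  have hin : HasDerivAt fInv (-d.root (d.y (T R) R) R / (2 * (d.q R * d.y (T R) R) ^ 2))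
      (d.phase (T R) R) := by
    refine (hasDerivAt_fInv hp).congr_deriv ?_
    rw [← hd.q_mul_y, root, mul_pow]
  have h2 := (HasDerivAt.comp_hasDerivWithinAt (h := fun x => d.phase (T x) x) R hin h1).div hqd hq.ne'
  refine h2.congr_deriv ?_
  simp only [Function.comp_apply, ← hd.q_mul_y]
  have hG := hd.g_y hp
  -- Once the time is written through `g`, the terms in `q'` assemble into `h` and those in `c'`
  -- into `g`, which is how `Λ` arises. What remains is algebra in independent symbols.
  have hT' : T R = g (d.q R) (d.y (T R) R) / √(d.c R) := by
    rw [hG, mul_div_cancel_left₀ _ (hd.sqrt_c_pos R).ne']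
  have hw : 0 < √(1 - d.q R ^ 2) := Real.sqrt_pos.2 (by nlinarith)
  have hS := hd.root_y_pos hp
  have hy := hd.y_pos hp
  have hsc := hd.sqrt_c_pos R
  have hcsq : d.c R = √(d.c R) ^ 2 := (Real.sq_sqrt hc.le).symm
  rw [Lam, h, speed]
  change _ = R * (2 * (divR (deriv d.q) R / d.q R) * (1 / √(1 - d.q R ^ 2)
    - d.y (T R) R ^ 3 / d.root (d.y (T R) R) R - 3 / 2 * g (d.q R) (d.y (T R) R)) - _) * _ / _ - _
  rw [show divR (deriv d.c) R / (2 * d.c R) = divR (deriv d.c) R / (2 * √(d.c R) ^ 2) by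
    rw [← hcsq]]
  generalize d.y (T R) R = y at *
  rw [hT']
  generalize g (d.q R) y = G at *
  generalize d.root y R = S at *
  generalize √(d.c R) = sc at *
  generalize √(1 - d.q R ^ 2) = w at *
  field_simp
  ring

/-- The converse of `hasDerivWithinAt_y`: the time at which the shell `R` has `y = Y(R)`. -/
lemma Admissible.hasDerivWithinAt_time (hd : d.Admissible) {Y : ℝ → ℝ} {Y' : ℝ} {s : Set ℝ}
    (hY0 : 0 < Y R) (hqY : d.q R * Y R < 1) (hY : HasDerivWithinAt Y Y' s R) :
    HasDerivWithinAt (fun x => g (d.q x) (Y x) / √(d.c x))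
      ((R * d.Lam (Y R) R * d.root (Y R) R / (2 * Y R ^ 2) - Y') / d.speed (Y R) R) s R := by
  have hq := hd.q_pos R
  have hq1 := hd.q_lt_one R
  have hc := hd.c_pos R
  have hqd : HasDerivWithinAt d.q (R * divR (deriv d.q) R) s R := by
    rw [← divR_mul _ hd.deriv_q_zero]; exact (hd.differentiable_q R).hasDerivAt.hasDerivWithinAt
  have hcd : HasDerivWithinAt d.c (R * divR (deriv d.c) R) s R := by
    rw [← divR_mul _ hd.deriv_c_zero]; exact (hd.differentiable_c R).hasDerivAt.hasDerivWithinAt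
  have hfq : HasDerivWithinAt (fun x => f (d.q x))
      (-(2 * d.q R ^ 2) / √(1 - d.q R ^ 2) * (R * divR (deriv d.q) R)) s R :=
    (hasDerivAt_f (by linarith) hq1).comp_hasDerivWithinAt R hqd
  have hpos : 0 < d.q R * Y R := by positivity
  have hfy : HasDerivWithinAt (fun x => f (d.q x * Y x))
      (-(2 * (d.q R * Y R) ^ 2) / d.root (Y R) R * (R * divR (deriv d.q) R * Y R + d.q R * Y'))
      s R := by
    have := (hasDerivAt_f (by linarith) hqY).comp_hasDerivWithinAt R (hqd.mul hY)
    refine this.congr_deriv ?_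
    simp only [root, mul_pow]
  have h2 := ((hfy.sub hfq).div (hqd.pow 3) (pow_pos hq 3).ne').div (hcd.sqrt hc.ne')
    (hd.sqrt_c_pos R).ne'
  refine h2.congr_deriv ?_
  simp only [Pi.sub_apply, Pi.div_apply, Pi.pow_apply]
  have hw : 0 < √(1 - d.q R ^ 2) := Real.sqrt_pos.2 (by nlinarith)
  have hS : 0 < d.root (Y R) R := root_pos_of hpos.le hqY
  have hsc := hd.sqrt_c_pos R
  have hcsq : d.c R = √(d.c R) ^ 2 := (Real.sq_sqrt hc.le).symm
  rw [Lam, h, speed, g]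
  change _ = (R * (2 * (divR (deriv d.q) R / d.q R) * (1 / √(1 - d.q R ^ 2)
    - Y R ^ 3 / d.root (Y R) R - _) - _) * _ / _ - _) / _
  rw [show divR (deriv d.c) R / (2 * d.c R) = divR (deriv d.c) R / (2 * √(d.c R) ^ 2) by
    rw [← hcsq]]
  generalize Y R = y at *
  generalize d.root y R = S at *
  generalize √(d.c R) = sc at *
  generalize √(1 - d.q R ^ 2) = w at *
  field_simp
  ring

lemma Admissible.hasDerivAt_y_time (hd : d.Admissible)
    (hp : d.phase τ R ∈ Ioo 0 (Real.pi / 2)) :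
    HasDerivAt (fun t => d.y t R) (-d.speed (d.y τ R) R) τ := by
  have h1 : HasDerivAt (fun t => d.phase t R) (√(d.c R) * d.q R ^ 3) τ := by
    have := ((hasDerivAt_id τ).const_mul (√(d.c R) * d.q R ^ 3)).const_add (f (d.q R))
    rwa [mul_one] at this
  refine (((hasDerivAt_fInv hp).comp τ h1).div_const (d.q R)).congr_deriv ?_
  rw [← hd.q_mul_y, mul_pow, speed]
  change -(d.root (d.y τ R) R) / _ * _ / _ = _
  have := hd.q_pos R
  have := hd.y_pos hp
  field_simp

lemma Admissible.hasDerivAt_r (hd : d.Admissible)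
    (hp : d.phase τ R ∈ Ioo 0 (Real.pi / 2)) :
    HasDerivAt (fun x => d.r τ x) (d.stretch (d.y τ R) R) R := by
  have h1 := hd.hasDerivWithinAt_y (T := fun _ => τ) (s := univ) hp
    (hasDerivWithinAt_const R univ τ)
  rw [hasDerivWithinAt_univ] at h1
  refine ((hasDerivAt_id R).mul (h1.pow 2)).congr_deriv ?_
  simp only [Pi.pow_apply, id, stretch]
  have := hd.y_pos hp
  push_cast
  field_simp
  ring

lemma Admissible.one_div_γ (hd : d.Admissible) (hp : d.phase τ R ∈ Ioo 0 (Real.pi / 2)) :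
    1 / d.γ τ R = d.stretch (d.y τ R) R / d.energy R := by
  rw [γ, (hd.hasDerivAt_r hp).deriv, one_div_div, energy]

lemma Admissible.hasDerivAt_stretch (hd : d.Admissible) {y : ℝ} (hy : 0 < y)
    (hqy : d.q R * y < 1) :
    HasDerivAt (fun y => d.stretch y R) (d.dStretch y R) y := by
  have hS : 0 < d.root y R := root_pos_of (mul_pos (hd.q_pos R) hy).le hqy
  have h1 := (hasDerivAt_pow 2 y).add ((((hd.hasDerivAt_Lam hy.le hqy).const_mul (R ^ 2)).mul
    (hd.hasDerivAt_root hy.le hqy)).div (hasDerivAt_id y) hy.ne')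
  refine h1.congr_deriv ?_
  have hsq : d.root y R ^ 2 = 1 - d.q R ^ 2 * y ^ 2 := by
    refine Real.sq_sqrt ?_
    nlinarith [mul_pos (hd.q_pos R) hy]
  simp only [Pi.mul_apply, id, dStretch]
  push_cast
  have hq : d.q R ^ 2 * y ^ 2 = 1 - d.root y R ^ 2 := by linarith
  field_simp
  linear_combination (-(R ^ 2 * d.Lam y R)) * hq

lemma continuous_phase_time (d : InitialData) (R : ℝ) : Continuous fun t => d.phase t R := by
  unfold phase; fun_prop

lemma Admissible.hasDerivAt_inv_γ_sq (hd : d.Admissible)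
    (hp : d.phase τ R ∈ Ioo 0 (Real.pi / 2)) :
    HasDerivAt (fun t => 1 / d.γ t R ^ 2)
      (-(2 * (1 / d.γ τ R) * (d.dStretch (d.y τ R) R * d.speed (d.y τ R) R / d.energy R))) τ := by
  have h1 := ((hd.hasDerivAt_stretch (hd.y_pos hp) (hd.q_mul_y_mem hp).2).comp τ
    (hd.hasDerivAt_y_time hp)).div_const (d.energy R)
  -- The formula for `1/γ` is available only while the phase lies in `(0, π/2)`, an open condition
  -- on `t`.
  have h2 := (h1.pow 2).congr_of_eventuallyEq (f₁ := fun t => 1 / d.γ t R ^ 2) (by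
    filter_upwards [(d.continuous_phase_time R).continuousAt.preimage_mem_nhds
      (Ioo_mem_nhds hp.1 hp.2)] with t ht
    simp only [Pi.pow_apply, Function.comp_apply]
    rw [← hd.one_div_γ ht, one_div_pow])
  refine h2.congr_deriv ?_
  rw [hd.one_div_γ hp]
  simp only [Function.comp_apply]
  push_cast
  ring

end

end InitialData

/-! ### The cube root -/

/-- The cube root. -/
def cbrt (x : ℝ) : ℝ := x ^ (1 / 3 : ℝ)

lemma cbrt_pow {x : ℝ} (hx : 0 ≤ x) : cbrt x ^ 3 = x := by
  have := Real.rpow_inv_natCast_pow hx (n := 3) (by norm_num)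
  simpa [cbrt] using this

lemma cbrt_nonneg {x : ℝ} (hx : 0 ≤ x) : 0 ≤ cbrt x := Real.rpow_nonneg hx _

lemma cbrt_pos {x : ℝ} (hx : 0 < x) : 0 < cbrt x := Real.rpow_pos_of_pos hx _

lemma cbrt_zero : cbrt 0 = 0 := Real.zero_rpow (by norm_num)

lemma continuous_cbrt : Continuous cbrt := Real.continuous_rpow_const (by norm_num)

lemma cbrt_le_cbrt {x y : ℝ} (hx : 0 ≤ x) (hxy : x ≤ y) : cbrt x ≤ cbrt y :=
  Real.rpow_le_rpow hx hxy (by norm_num)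

lemma cbrt_mul {x y : ℝ} (hx : 0 ≤ x) (hy : 0 ≤ y) : cbrt (x * y) = cbrt x * cbrt y :=
  Real.mul_rpow hx hy

lemma hasDerivAt_cbrt {x : ℝ} (hx : 0 < x) : HasDerivAt cbrt (1 / (3 * cbrt x ^ 2)) x := by
  refine (Real.hasDerivAt_rpow_const (p := 1 / 3) (Or.inl hx.ne')).congr_deriv ?_
  rw [Real.rpow_sub hx, Real.rpow_one]
  have h := cbrt_pos hx
  change 1 / 3 * (cbrt x / x) = _
  nth_rewrite 2 [← cbrt_pow hx.le]
  field_simp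

/-! ### A singular integral equation -/

/-- The singular integral equation `R² V(R) = ∫₀ᴿ s H(s, V(s)) ds` with `H` Lipschitz of
constant `1 < 2` in the second variable has a solution which is continuous up to `R = 0`. -/
lemma exists_singular_ode_solution {a : ℝ} (ha : 0 < a) {H : ℝ → ℝ → ℝ}
    (hH : ContinuousOn (fun p : ℝ × ℝ => H p.1 p.2) (Icc 0 a ×ˢ univ))
    (hL : ∀ s ∈ Icc 0 a, ∀ V W, |H s V - H s W| ≤ |V - W|) :
    ∃ V : ℝ → ℝ, Continuous V ∧ V 0 = H 0 (V 0) / 2 ∧ ∀ R ∈ Icc 0 a,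
      HasDerivWithinAt (fun x => x ^ 2 * V x) (R * H R (V R)) (Icc 0 a) R := by
  -- Here `π` is the projection onto `[0, a]`; it extends the integrand continuously to the whole
  -- line.
  set π : ℝ → ℝ := fun s => (projIcc 0 a ha.le s : ℝ) with hπ
  have hπc : Continuous π := continuous_subtype_val.comp continuous_projIcc
  have hπm : ∀ s, π s ∈ Icc 0 a := fun s => (projIcc 0 a ha.le s).2
  have hπe : ∀ s ∈ Icc 0 a, π s = s := fun s hs => by simp only [hπ, projIcc_of_mem ha.le hs]
  have hK : Continuous fun p : ℝ × ℝ => H (π p.1) p.2 :=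
    hH.comp_continuous (f := fun p : ℝ × ℝ => (π p.1, p.2)) (by fun_prop)
      fun p => ⟨hπm p.1, mem_univ _⟩
  have hext : ∀ V : C(Icc 0 a, ℝ), Continuous (IccExtend ha.le V) :=
    fun V => V.continuous.Icc_extend'
  have hcomp : ∀ W : ℝ → ℝ, Continuous W → Continuous fun s => H (π s) (W s) :=
    fun W hW => hK.comp (continuous_id.prodMk hW)
  -- The substitution `s = Rt` cancels `R²` and gives `V(R) = ∫₀¹ t H(Rt, V(Rt)) dt`. The weight
  -- `∫₀¹ t dt = 1/2` makes this a contraction in the sup norm, uniformly up to `R = 0`.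
  let Φ : C(Icc 0 a, ℝ) → C(Icc 0 a, ℝ) := fun V =>
    ⟨fun R => ∫ t in (0 : ℝ)..1, t * H (π (R * t)) (IccExtend ha.le V (R * t)), by
      refine intervalIntegral.continuous_parametric_intervalIntegral_of_continuous' ?_ _ _
      have := (hcomp _ (hext V)).comp (f := fun p : Icc 0 a × ℝ => (p.1 : ℝ) * p.2) (by fun_prop)
      exact continuous_snd.mul this⟩
  have hΦ : ContractingWith (1 / 2) Φ := by
    refine ⟨by rw [← NNReal.coe_lt_coe]; norm_num, LipschitzWith.of_dist_le_mul fun V W => ?_⟩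
    rw [ContinuousMap.dist_le (by positivity)]
    intro R
    have hmeas : ∀ V : C(Icc 0 a, ℝ), IntervalIntegrable
        (fun t : ℝ => t * H (π (R * t)) (IccExtend ha.le V (R * t))) MeasureTheory.volume 0 1 := by
      intro V
      have := (hcomp _ (hext V)).comp (f := fun t : ℝ => (R : ℝ) * t) (by fun_prop)
      exact (continuous_id.mul this).intervalIntegrable _ _
    rw [Real.dist_eq]
    simp only [Φ, ContinuousMap.coe_mk]
    rw [← intervalIntegral.integral_sub (hmeas V) (hmeas W), ← Real.norm_eq_abs]
    have hb : ∀ᵐ t, t ∈ Ioc (0 : ℝ) 1 →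
        ‖t * H (π (R * t)) (IccExtend ha.le V (R * t))
          - t * H (π (R * t)) (IccExtend ha.le W (R * t))‖ ≤ t * dist V W := by
      refine Eventually.of_forall fun t ht => ?_
      rw [← mul_sub, norm_mul, Real.norm_of_nonneg ht.1.le]
      refine mul_le_mul_of_nonneg_left ((hL _ (hπm _) _ _).trans ?_) ht.1.le
      rw [← Real.dist_eq]
      exact ContinuousMap.dist_apply_le_dist _
    refine (intervalIntegral.norm_integral_le_of_norm_le zero_le_one hb
      (Continuous.intervalIntegrable (by fun_prop) _ _)).trans (le_of_eq ?_)
    rw [intervalIntegral.integral_mul_const, integral_id]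
    norm_num
  set V := ContractingWith.fixedPoint Φ hΦ with hV
  have hfix : Φ V = V := hΦ.fixedPoint_isFixedPt
  set v : ℝ → ℝ := IccExtend ha.le V with hv
  have hvc : Continuous v := hext V
  have heq : ∀ R ∈ Icc 0 a, v R = ∫ t in (0 : ℝ)..1, t * H (π (R * t)) (v (R * t)) := by
    intro R hR
    have := congrArg (fun W : C(Icc 0 a, ℝ) => W ⟨R, hR⟩) hfix
    rw [hv, IccExtend_of_mem _ _ hR]
    exact this.symm
  have hGc : Continuous fun s => s * H (π s) (v s) := continuous_id.mul (hcomp v hvc)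
  have hint : ∀ R ∈ Icc 0 a, R ^ 2 * v R = ∫ s in (0 : ℝ)..R, s * H (π s) (v s) := by
    intro R hR
    have h1 := intervalIntegral.mul_integral_comp_mul_left (a := 0) (b := 1)
      (f := fun s => s * H (π s) (v s)) R
    rw [mul_zero, mul_one] at h1
    rw [← h1, heq R hR, pow_two, mul_assoc, ← intervalIntegral.integral_const_mul]
    congr 1
    exact intervalIntegral.integral_congr fun t _ => by ring
  refine ⟨v, hvc, ?_, fun R hR => ?_⟩
  · have h0 : (0 : ℝ) ∈ Icc 0 a := left_mem_Icc.2 ha.le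
    have h1 := heq 0 h0
    simp only [zero_mul] at h1
    rw [intervalIntegral.integral_mul_const, integral_id, hπe 0 h0] at h1
    rw [h1]
    nth_rewrite 2 [← h1]
    norm_num
    ring
  · have h1 : HasDerivAt (fun x => ∫ s in (0 : ℝ)..x, s * H (π s) (v s)) (R * H (π R) (v R)) R :=
      intervalIntegral.integral_hasDerivAt_right (hGc.intervalIntegrable _ _)
        (hGc.stronglyMeasurableAtFilter _ _) hGc.continuousAt
    rw [hπe R hR] at h1
    exact h1.hasDerivWithinAt.congr (fun x hx => hint x hx) (hint R hR)

namespace InitialData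

variable {d : InitialData}

/-! ### Upper bound for rays from the singularity -/

lemma Admissible.phase_τs (hd : d.Admissible) (R : ℝ) : d.phase (d.τs R) R = Real.pi / 2 := by
  have := hd.sqrt_c_pos R
  have := hd.q_pos R
  rw [phase, τs]
  field_simp
  ring

lemma Admissible.tendsto_phase_ray (hd : d.Admissible) {T : ℝ → ℝ} {a : ℝ}
    (hT : d.IsRayFromSingularity T a) :
    Tendsto (fun R => d.phase (T R) R) (𝓝[>] 0) (𝓝 (Real.pi / 2)) := by
  have hq := hd.continuous_q
  have hc := hd.continuous_c
  have hf := continuous_f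
  have h1 : Continuous fun p : ℝ × ℝ => d.phase p.1 p.2 := by unfold phase; fun_prop
  have h2 := (h1.tendsto (d.τs 0, 0)).comp
    (hT.lim.prodMk_nhds (tendsto_nhdsWithin_of_tendsto_nhds tendsto_id))
  rwa [hd.phase_τs] at h2

/-- Along an outgoing ray the time term only decreases `y`, so `(y³)' ≤ (3/2) R Λ √(1 - q²y²) ≤
(3/2) M R` with `M` a bound for `|Λ|`. Integration from the singularity, where `y → 0`, gives the
constant `3M/4`. -/
lemma Admissible.exists_ray_le (hd : d.Admissible) :
    ∃ C : ℝ, 0 ≤ C ∧ ∀ a ∈ Ioc (0 : ℝ) 1, ∀ T, d.IsRayFromSingularity T a →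
      d.y (T a) a ^ 3 ≤ C * a ^ 2 := by
  have hcompact : IsCompact (Icc (0 : ℝ) 1 ×ˢ Icc (0 : ℝ) 1) := isCompact_Icc.prod isCompact_Icc
  obtain ⟨M, hM⟩ := hcompact.exists_bound_of_continuousOn
    (hd.continuousOn_Lam.mono (prod_mono_right (subset_univ _)))
  have hM0 : 0 ≤ M := (norm_nonneg _).trans (hM (0, 0) (by simp))
  refine ⟨3 / 4 * M, by positivity, fun a ha T hT => ?_⟩
  have hder : ∀ R ∈ Ioc 0 a, HasDerivWithinAt (fun x => d.y (T x) x ^ 3 - 3 / 4 * M * x ^ 2)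
      (3 * d.y (T R) R ^ 2 * (R * d.Lam (d.y (T R) R) R * d.root (d.y (T R) R) R
        / (2 * d.y (T R) R ^ 2) - d.speed (d.y (T R) R) R * (1 / d.γ (T R) R))
        - 3 / 4 * M * (2 * R)) (Ioc 0 a) R := by
    intro R hR
    have hm := hT.mem R hR
    have h1 := hd.hasDerivWithinAt_y (hd.phase_mem hm.1 hm.2) (hT.ode R hR)
    refine ((h1.pow 3).sub
      (((hasDerivAt_pow 2 R).const_mul (3 / 4 * M)).hasDerivWithinAt)).congr_deriv ?_
    norm_num
  have hanti : AntitoneOn (fun x => d.y (T x) x ^ 3 - 3 / 4 * M * x ^ 2) (Ioc 0 a) := by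
    refine antitoneOn_of_hasDerivWithinAt_nonpos (convex_Ioc 0 a)
      (fun R hR => (hder R hR).continuousWithinAt)
      (fun R hR => (hder R (interior_subset hR)).mono interior_subset) ?_
    intro R hR
    replace hR := interior_subset hR
    have hm := hT.mem R hR
    have hp := hd.phase_mem hm.1 hm.2
    have hy := hd.y_mem hm.1 hm.2
    have hyc := Ioc_subset_Icc_self hy
    have hL := hd.Lam_nonneg hR.1.le hyc
    have hLM := (le_abs_self _).trans (hM (d.y (T R) R, R) ⟨hyc, hR.1.le, hR.2.trans ha.2⟩)
    have hS := hd.root_y_pos hp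
    have hS1 := root_le_one (d := d) (y := d.y (T R) R) (R := R)
    rw [hd.one_div_γ hp]
    have he := hd.energy_pos R
    have hR0 := hR.1
    have hy0 := hy.1
    have h2 : 0 ≤ d.speed (d.y (T R) R) R * (d.stretch (d.y (T R) R) R / d.energy R) := by
      unfold speed stretch; positivity
    have h3 : 3 * d.y (T R) R ^ 2 * (R * d.Lam (d.y (T R) R) R * d.root (d.y (T R) R) R
        / (2 * d.y (T R) R ^ 2)) =
        3 / 2 * R * (d.Lam (d.y (T R) R) R * d.root (d.y (T R) R) R) := by
      field_simp
    have h4 : d.Lam (d.y (T R) R) R * d.root (d.y (T R) R) R ≤ M := by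
      simp only at hLM
      nlinarith
    have h5 := mul_nonneg (show 0 ≤ 3 * d.y (T R) R ^ 2 by positivity) h2
    rw [mul_sub, h3]
    nlinarith
  have hlim : Tendsto (fun x => d.y (T x) x ^ 3 - 3 / 4 * M * x ^ 2) (𝓝[>] 0) (𝓝 0) := by
    have hmem : ∀ᶠ R in 𝓝[>] (0 : ℝ), R ∈ Ioc 0 a := Ioc_mem_nhdsGT ha.1
    have h1 : Tendsto (fun x => d.y (T x) x ^ 3) (𝓝[>] 0) (𝓝 0) := by
      -- By `cube_le_sub_f`, this expression dominates `y³`; it tends to `0` because the phase tends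
      -- to `π/2` at the singularity.
      have h2 : Tendsto (fun R => 3 / 2 * (Real.pi / 2 - d.phase (T R) R) / d.q R ^ 3)
          (𝓝[>] 0) (𝓝 (3 / 2 * (Real.pi / 2 - Real.pi / 2) / d.q 0 ^ 3)) :=
        (((hd.tendsto_phase_ray hT).const_sub _).const_mul _).div
          (((hd.continuous_q.tendsto 0).mono_left nhdsWithin_le_nhds).pow 3)
          (pow_pos (hd.q_pos 0) 3).ne'
      rw [sub_self, mul_zero, zero_div] at h2
      refine tendsto_of_tendsto_of_tendsto_of_le_of_le' tendsto_const_nhds h2 ?_ ?_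
      · filter_upwards [hmem] with R hR
        have hm := hT.mem R hR
        have := (hd.y_mem hm.1 hm.2).1
        positivity
      · filter_upwards [hmem] with R hR
        have hm := hT.mem R hR
        have hp := hd.phase_mem hm.1 hm.2
        rw [le_div_iff₀ (pow_pos (hd.q_pos R) 3)]
        have h3 := cube_le_sub_f (Ioo_subset_Icc_self (hd.q_mul_y_mem hp))
        rw [hd.f_q_mul_y hp, mul_pow] at h3
        linarith
    have h2 : Tendsto (fun x : ℝ => 3 / 4 * M * x ^ 2) (𝓝[>] 0) (𝓝 (3 / 4 * M * 0 ^ 2)) :=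
      ((Continuous.tendsto (by fun_prop) 0)).mono_left nhdsWithin_le_nhds
    simpa using h1.sub h2
  have hfin : d.y (T a) a ^ 3 - 3 / 4 * M * a ^ 2 ≤ 0 := by
    refine ge_of_tendsto hlim ?_
    filter_upwards [Ioc_mem_nhdsGT ha.1] with x hx
    exact hanti hx ⟨ha.1, le_rfl⟩ hx.2
  linarith

lemma IsRayFromSingularity.mono {T : ℝ → ℝ} {a b : ℝ} (hT : d.IsRayFromSingularity T a)
    (hb : b ≤ a) : d.IsRayFromSingularity T b where
  mem R hR := hT.mem R ⟨hR.1, hR.2.trans hb⟩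
  ode R hR := (hT.ode R ⟨hR.1, hR.2.trans hb⟩).mono (Ioc_subset_Ioc_right hb)
  lim := hT.lim

lemma Admissible.y_le_yCH (hd : d.Admissible) {T : ℝ → ℝ} {R : ℝ} (hR : 0 < R)
    (hT : d.IsRayFromSingularity T R) : d.y (T R) R ≤ d.yCH R := by
  -- The bound `y ≤ 1` makes the real supremum in `yCH` an actual upper bound.
  refine le_csSup ⟨1, ?_⟩ ⟨hR, T, hT, rfl⟩
  rintro w ⟨_, T', hT', rfl⟩
  have := hT'.mem R ⟨hR, le_rfl⟩
  exact hd.y_le_one this.1 this.2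

lemma Admissible.yCH_nonneg (hd : d.Admissible) (R : ℝ) : 0 ≤ d.yCH R := by
  refine Real.sSup_nonneg ?_
  rintro w ⟨hR, T, hT, rfl⟩
  have := hT.mem R ⟨hR, le_rfl⟩
  exact (hd.y_mem this.1 this.2).1.le

lemma yCH_zero (d : InitialData) : d.yCH 0 = 0 := by
  simp [yCH]

lemma Admissible.exists_yCH_le (hd : d.Admissible) :
    ∃ C : ℝ, 0 ≤ C ∧ ∀ a ∈ Icc (0 : ℝ) 1, d.yCH a ≤ cbrt (C * a ^ 2) := by
  obtain ⟨C, hC, h⟩ := hd.exists_ray_le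
  refine ⟨C, hC, fun a ha => Real.sSup_le ?_ (cbrt_nonneg (by positivity))⟩
  rintro w ⟨h0, T, hT, rfl⟩
  have hm := hT.mem a ⟨h0, le_rfl⟩
  have h1 := h a ⟨h0, ha.2⟩ T hT
  refine le_of_pow_le_pow_left₀ three_ne_zero (cbrt_nonneg (by positivity)) ?_
  rwa [cbrt_pow (by positivity)]

lemma Admissible.tendsto_yCH (hd : d.Admissible) : Tendsto d.yCH (𝓝[≥] 0) (𝓝 0) := by
  obtain ⟨C, hC, h⟩ := hd.exists_yCH_le
  have hc := continuous_cbrt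
  have h1 : Tendsto (fun a => cbrt (C * a ^ 2)) (𝓝[≥] 0) (𝓝 (cbrt (C * 0 ^ 2))) :=
    (Continuous.tendsto (by fun_prop) 0).mono_left nhdsWithin_le_nhds
  rw [zero_pow two_ne_zero, mul_zero, cbrt_zero] at h1
  refine tendsto_of_tendsto_of_tendsto_of_le_of_le' tendsto_const_nhds h1
    (Eventually.of_forall hd.yCH_nonneg) ?_
  filter_upwards [Icc_mem_nhdsGE (zero_lt_one' ℝ)] with a ha using h a ha

/-! ### Construction of a ray from the singularity with prescribed asymptotics -/

/-- The right-hand side of the null ray equation for `V = y³/R²`, as a function of `s = R` and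
`k = V^{1/3}`. -/
def rayField (d : InitialData) (s k : ℝ) : ℝ :=
  3 / 2 * d.root (cbrt s ^ 2 * k) s * (d.Lam (cbrt s ^ 2 * k) s
    - cbrt s * (√(d.c s) / d.energy s)
      * (k ^ 2 + d.Lam (cbrt s ^ 2 * k) s * d.root (cbrt s ^ 2 * k) s / k))

/-- `∂(rayField)/∂k` is `s^{1/3}` times this function. -/
def rayFieldDeriv (d : InitialData) (s k : ℝ) : ℝ :=
  3 / 2 * (-(d.q s ^ 2 * (cbrt s ^ 2 * k)) / d.root (cbrt s ^ 2 * k) s * cbrt s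
      * (d.Lam (cbrt s ^ 2 * k) s - cbrt s * (√(d.c s) / d.energy s)
        * (k ^ 2 + d.Lam (cbrt s ^ 2 * k) s * d.root (cbrt s ^ 2 * k) s / k))
    + d.root (cbrt s ^ 2 * k) s * (d.dLam (cbrt s ^ 2 * k) s * cbrt s
      - √(d.c s) / d.energy s * (2 * k
        + ((d.dLam (cbrt s ^ 2 * k) s * d.root (cbrt s ^ 2 * k) s
          + d.Lam (cbrt s ^ 2 * k) s
            * (-(d.q s ^ 2 * (cbrt s ^ 2 * k)) / d.root (cbrt s ^ 2 * k) s)) * cbrt s ^ 2 * k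
          - d.Lam (cbrt s ^ 2 * k) s * d.root (cbrt s ^ 2 * k) s) / k ^ 2)))

/-- The variable `k` enters either through `y = s^(2/3) k` or inside a term with prefactor
`s^(1/3)`, so the whole derivative carries a factor `s^(1/3)`. -/
lemma Admissible.hasDerivAt_rayField (hd : d.Admissible) {s k : ℝ} (hk : 0 < k)
    (hy : cbrt s ^ 2 * k ≤ 1) :
    HasDerivAt (fun k => d.rayField s k) (cbrt s * d.rayFieldDeriv s k) k := by
  have hy0 : 0 ≤ cbrt s ^ 2 * k := by positivity
  have hqy := hd.q_mul_lt_one (R := s) ⟨hy0, hy⟩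
  have hlin : HasDerivAt (fun k => cbrt s ^ 2 * k) (cbrt s ^ 2) k := by
    simpa using (hasDerivAt_id k).const_mul (cbrt s ^ 2)
  have hS : HasDerivAt (fun k => d.root (cbrt s ^ 2 * k) s) _ k :=
    (hd.hasDerivAt_root hy0 hqy).comp k hlin
  have hL : HasDerivAt (fun k => d.Lam (cbrt s ^ 2 * k) s) _ k :=
    (hd.hasDerivAt_Lam hy0 hqy).comp k hlin
  have h := (hS.const_mul (3 / 2)).mul (hL.sub (((hasDerivAt_pow 2 k).add
    ((hL.mul hS).div (hasDerivAt_id k) hk.ne')).const_mul (cbrt s * (√(d.c s) / d.energy s))))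
  refine h.congr_deriv ?_
  simp only [Pi.mul_apply, Pi.sub_apply, Pi.add_apply, Pi.div_apply, id, rayFieldDeriv]
  push_cast
  ring

lemma Admissible.continuousOn_rayField (hd : d.Admissible) {a k₁ k₂ : ℝ} (hk₁ : 0 < k₁)
    (ha : ∀ s ∈ Icc 0 a, cbrt s ^ 2 * k₂ ≤ 1) :
    ContinuousOn (fun p : ℝ × ℝ => d.rayField p.1 p.2) (Icc 0 a ×ˢ Icc k₁ k₂) ∧
    ContinuousOn (fun p : ℝ × ℝ => d.rayFieldDeriv p.1 p.2) (Icc 0 a ×ˢ Icc k₁ k₂) := by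
  have hcb := continuous_cbrt
  have hc := hd.continuous_c
  have hq := hd.continuous_q
  have he := hd.continuous_energy
  have hA : Continuous fun s => √(d.c s) / d.energy s :=
    (by fun_prop : Continuous fun s => √(d.c s)).div he fun s => (hd.energy_pos s).ne'
  have hk : ∀ p ∈ Icc 0 a ×ˢ Icc k₁ k₂, p.2 ≠ 0 := fun p hp => (hk₁.trans_le hp.2.1).ne'
  have hmap : MapsTo (fun p : ℝ × ℝ => (cbrt p.1 ^ 2 * p.2, p.1)) (Icc 0 a ×ˢ Icc k₁ k₂)
      (Icc 0 1 ×ˢ univ) := by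
    intro p hp
    have hp2 := hk₁.le.trans hp.2.1
    refine ⟨⟨by positivity, ?_⟩, mem_univ _⟩
    exact (mul_le_mul_of_nonneg_left hp.2.2 (sq_nonneg _)).trans (ha p.1 hp.1)
  have hmc : Continuous fun p : ℝ × ℝ => (cbrt p.1 ^ 2 * p.2, p.1) := by fun_prop
  have hL := hd.continuousOn_Lam.comp hmc.continuousOn hmap
  have hL' := hd.continuousOn_dLam.comp hmc.continuousOn hmap
  have hS := (hd.continuous_root.comp hmc).continuousOn (s := Icc 0 a ×ˢ Icc k₁ k₂)
  have hS0 : ∀ p ∈ Icc 0 a ×ˢ Icc k₁ k₂, d.root (cbrt p.1 ^ 2 * p.2) p.1 ≠ 0 :=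
    fun p hp => (hd.root_pos (hmap hp).1).ne'
  simp only [Function.comp_def] at hL hL' hS
  have hcb1 := (hcb.comp continuous_fst).continuousOn (s := Icc 0 a ×ˢ Icc k₁ k₂)
  have hq1 := (hq.comp continuous_fst).continuousOn (s := Icc 0 a ×ˢ Icc k₁ k₂)
  have hA1 := (hA.comp continuous_fst).continuousOn (s := Icc 0 a ×ˢ Icc k₁ k₂)
  simp only [Function.comp_def] at hcb1 hq1 hA1
  unfold rayField rayFieldDeriv
  constructor
  · fun_prop (disch := assumption)
  · have hk2 : ∀ p ∈ Icc 0 a ×ˢ Icc k₁ k₂, p.2 ^ 2 ≠ 0 := fun p hp => pow_ne_zero 2 (hk p hp)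
    fun_prop (disch := assumption)

end InitialData

/-- Factor the difference of two cubes; the quadratic factor is at least `3 m^(2/3)`. -/
lemma abs_cbrt_sub_le {m x y : ℝ} (hm : 0 < m) (hx : m ≤ x) (hy : m ≤ y) :
    3 * cbrt m ^ 2 * |cbrt x - cbrt y| ≤ |x - y| := by
  have hx0 := hm.trans_le hx
  have hy0 := hm.trans_le hy
  have h1 := cbrt_pos hm
  have h2 := cbrt_le_cbrt hm.le hx
  have h3 := cbrt_le_cbrt hm.le hy
  have h4 : x - y = (cbrt x ^ 2 + cbrt x * cbrt y + cbrt y ^ 2) * (cbrt x - cbrt y) := by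
    nth_rewrite 1 [← cbrt_pow hx0.le, ← cbrt_pow hy0.le]
    ring
  rw [h4, abs_mul]
  refine mul_le_mul_of_nonneg_right ((?_ : _ ≤ _).trans (le_abs_self _)) (abs_nonneg _)
  nlinarith

/-- The projection of `V` to the interval `[x/2, 2x]`. -/
def clampNear (x V : ℝ) : ℝ := max (x / 2) (min V (2 * x))

lemma clampNear_mem {x : ℝ} (hx : 0 < x) (V : ℝ) : clampNear x V ∈ Icc (x / 2) (2 * x) :=
  ⟨le_max_left _ _, max_le (by linarith) (min_le_right _ _)⟩

lemma clampNear_eq {x V : ℝ} (hV : V ∈ Icc (x / 2) (2 * x)) : clampNear x V = V := by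
  rw [clampNear, min_eq_left hV.2, max_eq_right hV.1]

lemma abs_clampNear_sub_le (x V W : ℝ) : |clampNear x V - clampNear x W| ≤ |V - W| := by
  unfold clampNear
  exact (abs_max_sub_max_le_max _ _ _ _).trans (by
    rw [sub_self, abs_zero, max_eq_right (abs_nonneg _)]
    exact (abs_min_sub_min_le_max _ _ _ _).trans (by simp))

/-- An eventual property at `0⁺` holds on some interval `[0, a]`. -/
lemma exists_Icc_of_eventually {P : ℝ → Prop} (h : ∀ᶠ s in 𝓝[≥] (0 : ℝ), P s) :
    ∃ a > 0, ∀ s ∈ Icc 0 a, P s := by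
  obtain ⟨a, ha, hs⟩ := (mem_nhdsGE_iff_exists_Icc_subset (a := (0 : ℝ))).1 h
  exact ⟨a, ha, fun s hsa => hs hsa⟩

/-! ### Solving the ray equation near the central singularity -/

namespace InitialData

variable {d : InitialData}

/-- The `k`-derivative is `s^(1/3)` times a function bounded on compact sets, so any `L > 0` is a
Lipschitz constant on a short enough interval. -/
lemma Admissible.exists_abs_rayField_sub_le (hd : d.Admissible) {k₁ k₂ L : ℝ} (hk₁ : 0 < k₁)
    (hL : 0 < L) :
    ∃ a > 0, (∀ s ∈ Icc 0 a, cbrt s ^ 2 * k₂ ≤ 1) ∧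
      ∀ s ∈ Icc 0 a, ∀ k ∈ Icc k₁ k₂, ∀ k' ∈ Icc k₁ k₂,
        |d.rayField s k - d.rayField s k'| ≤ L * |k - k'| := by
  have hcb := continuous_cbrt
  have hlim : ∀ F : ℝ → ℝ, Continuous F → ∀ b, F 0 < b → ∀ᶠ s in 𝓝[≥] (0 : ℝ), F s ≤ b :=
    fun F hF b hb => nhdsWithin_le_nhds ((hF.tendsto 0).eventually_le_const hb)
  obtain ⟨a₀, ha₀, h₀⟩ := exists_Icc_of_eventually
    (hlim (fun s => cbrt s ^ 2 * k₂) (by fun_prop) 1 (by simp [cbrt_zero]))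
  obtain ⟨M, hM⟩ := (isCompact_Icc.prod isCompact_Icc).exists_bound_of_continuousOn
    (hd.continuousOn_rayField hk₁ h₀).2
  obtain ⟨a₁, ha₁, h₁⟩ := exists_Icc_of_eventually
    (hlim (fun s => cbrt s * M) (by fun_prop) L (by simpa [cbrt_zero] using hL))
  refine ⟨min a₀ a₁, lt_min ha₀ ha₁, fun s hs => h₀ s ⟨hs.1, hs.2.trans (min_le_left _ _)⟩,
    fun s hs k hk k' hk' => ?_⟩
  have hs0 : s ∈ Icc 0 a₀ := ⟨hs.1, hs.2.trans (min_le_left _ _)⟩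
  refine (convex_Icc k₁ k₂).norm_image_sub_le_of_norm_hasDerivWithin_le
    (f' := fun k => cbrt s * d.rayFieldDeriv s k) (fun k hk => ?_) (fun k hk => ?_) hk' hk
  · refine (hd.hasDerivAt_rayField (hk₁.trans_le hk.1) ?_).hasDerivWithinAt
    exact (mul_le_mul_of_nonneg_left hk.2 (sq_nonneg _)).trans (h₀ s hs0)
  · rw [norm_mul, Real.norm_of_nonneg (cbrt_nonneg hs.1)]
    exact (mul_le_mul_of_nonneg_left (hM (s, k) ⟨hs0, hk⟩) (cbrt_nonneg hs.1)).trans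
      (h₁ s ⟨hs.1, hs.2.trans (min_le_right _ _)⟩)

lemma Admissible.rayField_zero (_hd : d.Admissible) (k : ℝ) :
    d.rayField 0 k = 3 / 2 * d.Lam 0 0 := by
  simp [rayField, cbrt_zero, root]

/-- Clamping `V` to `[x/2, 2x]` around the expected limit `x = 3Λ₀/4` makes the field globally
Lipschitz. The solution starts at `x`, so by continuity the clamp is inactive near the centre. -/
lemma Admissible.exists_rayField_solution (hd : d.Admissible) :
    ∃ a > 0, ∃ V : ℝ → ℝ, Continuous V ∧ V 0 = 3 / 4 * d.Lam 0 0 ∧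
      ∀ R ∈ Icc 0 a, 0 < V R ∧ cbrt R ^ 2 * cbrt (V R) ≤ 1 ∧
        HasDerivWithinAt (fun x => x ^ 2 * V x) (R * d.rayField R (cbrt (V R))) (Icc 0 a) R := by
  have hcb := continuous_cbrt
  set x := 3 / 4 * d.Lam 0 0 with hx
  have hx0 : 0 < x := by have := hd.Lam_zero_pos; positivity
  have hk₁ : 0 < cbrt (x / 2) := cbrt_pos (by positivity)
  -- This `L` offsets the Lipschitz constant `1/(3 (x/2)^(2/3))` of the cube root on `[x/2, ∞)`,
  -- leaving the constant `1` in `V`.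
  obtain ⟨a, ha, hy, hlip⟩ := hd.exists_abs_rayField_sub_le (k₂ := cbrt (2 * x))
    (L := 3 * cbrt (x / 2) ^ 2) hk₁ (by positivity)
  have hmem : ∀ V, cbrt (clampNear x V) ∈ Icc (cbrt (x / 2)) (cbrt (2 * x)) := fun V =>
    ⟨cbrt_le_cbrt (by positivity) (clampNear_mem hx0 V).1,
      cbrt_le_cbrt ((by positivity : 0 ≤ x / 2).trans (clampNear_mem hx0 V).1)
        (clampNear_mem hx0 V).2⟩
  have hclc : Continuous (clampNear x) := by unfold clampNear; fun_prop
  obtain ⟨V, hVc, hV0, hV⟩ := exists_singular_ode_solution ha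
    (H := fun s V => d.rayField s (cbrt (clampNear x V))) (by
      refine (hd.continuousOn_rayField hk₁ hy).1.comp
        (f := fun p : ℝ × ℝ => (p.1, cbrt (clampNear x p.2)))
        (Continuous.continuousOn (by fun_prop)) fun p hp => ⟨hp.1, hmem p.2⟩) (by
      intro s hs V W
      refine (hlip s hs _ (hmem V) _ (hmem W)).trans ?_
      exact (abs_cbrt_sub_le (by positivity) (clampNear_mem hx0 V).1 (clampNear_mem hx0 W).1).trans
        (abs_clampNear_sub_le x V W))
  rw [hd.rayField_zero] at hV0
  have hV0' : V 0 = x := by rw [hV0, hx]; ring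
  obtain ⟨b, hb, hVb⟩ := exists_Icc_of_eventually (P := fun s => V s ∈ Icc (x / 2) (2 * x))
    (nhdsWithin_le_nhds ((hVc.tendsto 0).eventually_mem (Icc_mem_nhds (by linarith) (by linarith))))
  refine ⟨min a b, lt_min ha hb, V, hVc, hV0', fun R hR => ?_⟩
  have hRa : R ∈ Icc 0 a := ⟨hR.1, hR.2.trans (min_le_left _ _)⟩
  have hVR := hVb R ⟨hR.1, hR.2.trans (min_le_right _ _)⟩
  have h1 := hV R hRa
  have h2 := (hmem (V R)).2
  rw [clampNear_eq hVR] at h1 h2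
  exact ⟨(by positivity : 0 < x / 2).trans_le hVR.1,
    (mul_le_mul_of_nonneg_left h2 (sq_nonneg _)).trans (hy R hRa),
    h1.mono (Icc_subset_Icc_right (min_le_left _ _))⟩

/-- There is a ray from the central singularity with `y³ ~ (3Λ₀/4) R²`. -/
lemma Admissible.exists_ray (hd : d.Admissible) :
    ∃ a > 0, ∃ V : ℝ → ℝ, Continuous V ∧ V 0 = 3 / 4 * d.Lam 0 0 ∧
      ∃ T, d.IsRayFromSingularity T a ∧ ∀ R ∈ Ioc 0 a, d.y (T R) R ^ 3 = R ^ 2 * V R := by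
  obtain ⟨a, ha, V, hVc, hV0, hV⟩ := hd.exists_rayField_solution
  have hcb := continuous_cbrt
  set Y : ℝ → ℝ := fun R => cbrt (R ^ 2 * V R) with hY
  have hYc : Continuous Y := by fun_prop
  -- Since `g(q, y) = √c τ`, this is the time at which the shell `R` has `y = Y R`.
  set T : ℝ → ℝ := fun R => g (d.q R) (Y R) / √(d.c R) with hT
  have hmem : ∀ R ∈ Ioc 0 a, 0 < Y R ∧ Y R ≤ 1 ∧ Y R = cbrt R ^ 2 * cbrt (V R) := by
    intro R hR
    obtain ⟨h1, h2, _⟩ := hV R (Ioc_subset_Icc_self hR)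
    have hR0 := hR.1
    have h3 : Y R = cbrt R ^ 2 * cbrt (V R) := by
      simp only [hY]
      rw [cbrt_mul (by positivity) h1.le, pow_two R, cbrt_mul hR0.le hR0.le, pow_two]
    exact ⟨cbrt_pos (by positivity), h3 ▸ h2, h3⟩
  have hqY : ∀ R ∈ Ioc 0 a, d.q R * Y R ∈ Ioo (0 : ℝ) 1 := fun R hR =>
    ⟨mul_pos (hd.q_pos R) (hmem R hR).1, hd.q_mul_lt_one ⟨(hmem R hR).1.le, (hmem R hR).2.1⟩⟩
  have hphase : ∀ R ∈ Ioc 0 a, d.phase (T R) R = f (d.q R * Y R) := by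
    intro R _
    have := hd.sqrt_c_pos R
    have := hd.q_pos R
    simp only [phase, hT, g]
    field_simp
    ring
  have hyT : ∀ R ∈ Ioc 0 a, d.y (T R) R = Y R := by
    intro R hR
    rw [y_eq, hphase R hR, fInv_f (Ioo_subset_Icc_self (hqY R hR)),
      mul_div_cancel_left₀ _ (hd.q_pos R).ne']
  have hTmem : ∀ R ∈ Ioc 0 a, 0 ≤ T R ∧ T R < d.τs R := by
    intro R hR
    have hk : 0 < √(d.c R) * d.q R ^ 3 := mul_pos (hd.sqrt_c_pos R) (pow_pos (hd.q_pos R) 3)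
    refine ⟨div_nonneg (g_nonneg (hd.q_pos R) (hd.q_lt_one R)
      ⟨(hmem R hR).1.le, (hmem R hR).2.1⟩) (Real.sqrt_nonneg _), ?_⟩
    have h1 := strictAntiOn_f (a := 0) (by simp) (Ioo_subset_Icc_self (hqY R hR)) (hqY R hR).1
    rw [← hphase R hR, f_zero, phase] at h1
    rw [τs, lt_div_iff₀ hk]
    linarith
  refine ⟨a, ha, V, hVc, hV0, T, ⟨hTmem, fun R hR => ?_, ?_⟩, fun R hR => ?_⟩
  · have hp := hd.phase_mem (hTmem R hR).1 (hTmem R hR).2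
    obtain ⟨h1, h2, h3⟩ := hV R (Ioc_subset_Icc_self hR)
    obtain ⟨hY0, hY1, hYe⟩ := hmem R hR
    have hR0 := hR.1
    have hder : HasDerivWithinAt Y (1 / (3 * Y R ^ 2) * (R * d.rayField R (cbrt (V R))))
        (Ioc 0 a) R :=
      (hasDerivAt_cbrt (by positivity)).comp_hasDerivWithinAt
        (h := fun x => x ^ 2 * V x) R (h3.mono Ioc_subset_Icc_self)
    have := hd.hasDerivWithinAt_time hY0 (hqY R hR).2 hder
    refine this.congr_deriv ?_
    rw [hd.one_div_γ hp, hyT R hR, rayField, ← hYe, speed, stretch]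
    have hp0 := cbrt_pos hR0
    have hk0 := cbrt_pos h1
    have hS : 0 < d.root (Y R) R := hd.root_pos ⟨hY0.le, hY1⟩
    have he := hd.energy_pos R
    have hc := hd.sqrt_c_pos R
    generalize d.root (Y R) R = S at *
    generalize d.Lam (Y R) R = L at *
    rw [hYe]
    -- With `p = R^(1/3)` as variable all fractional powers disappear and the ray equation is a
    -- rational identity.
    have hRp : R = cbrt R ^ 3 := (cbrt_pow hR0.le).symm
    generalize √(d.c R) = c at *
    generalize d.energy R = e at *
    generalize cbrt (V R) = k at *
    generalize cbrt R = p at *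
    subst hRp
    field_simp
    ring
  · have hTc : Continuous T :=
      (hd.continuous_g.comp (hYc.prodMk continuous_id)).div
        (by have := hd.continuous_c; fun_prop) fun R => (hd.sqrt_c_pos R).ne'
    have h0 : T 0 = d.τs 0 := by
      have := hd.sqrt_c_pos 0
      have := hd.q_pos 0
      simp only [hT, hY, g, τs]
      norm_num [cbrt_zero, f_zero]
      field_simp
    rw [← h0]
    exact (hTc.tendsto 0).mono_left nhdsWithin_le_nhds
  · rw [hyT R hR]
    have hR0 := hR.1
    have := (hV R (Ioc_subset_Icc_self hR)).1
    exact cbrt_pow (by positivity)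

/-! ### Lower bounds for the Cauchy horizon and admissible choices -/

/-- The constructed ray, cut off at any smaller `R`, competes in the supremum defining `y_CH(R)`,
and its `y³/R²` tends to `3Λ₀/4`. -/
lemma Admissible.eventually_le_yCH_pow (hd : d.Admissible) {ε : ℝ} (hε : 0 < ε) :
    ∀ᶠ R in 𝓝[≥] (0 : ℝ), 3 * d.Lam 0 0 / 4 * R ^ 2 * (1 - ε) ≤ d.yCH R ^ 3 := by
  obtain ⟨a, ha, V, hVc, hV0, T, hT, hTV⟩ := hd.exists_ray
  have hΛ := hd.Lam_zero_pos
  have h1 : ∀ᶠ R in 𝓝[≥] (0 : ℝ), 3 / 4 * d.Lam 0 0 * (1 - ε) ≤ V R :=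
    nhdsWithin_le_nhds ((hVc.tendsto 0).eventually_const_le (by rw [hV0]; nlinarith))
  filter_upwards [h1, Icc_mem_nhdsGE ha] with R hR hRa
  rcases hRa.1.eq_or_lt with rfl | hR0
  · simp [yCH_zero]
  · have h2 := hd.y_le_yCH hR0 (hT.mono hRa.2)
    have hm := hT.mem R ⟨hR0, hRa.2⟩
    have h3 := pow_le_pow_left₀ (hd.y_mem hm.1 hm.2).1.le h2 3
    rw [hTV R ⟨hR0, hRa.2⟩] at h3
    nlinarith [sq_nonneg R]

lemma Admissible.exists_isRegionFamily (hd : d.Admissible) : ∃ Rf : ℝ → ℝ, d.IsRegionFamily Rf := by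
  have hΛ := hd.Lam_zero_pos
  have key : ∀ ε : ℝ, 0 < ε → ∃ a > 0, ∀ R ∈ Icc 0 a,
      3 * d.Lam 0 0 / 4 * R ^ 2 * (1 - ε) ≤ d.yCH R ^ 3 ∧
      ∀ R' ∈ Icc 0 R, ∀ w ∈ Icc 0 (d.yCH R), d.Lam w R' ≤ (1 + ε) * d.Lam 0 0 := by
    intro ε hε
    have h1 : ∀ᶠ p in 𝓝[Icc 0 1 ×ˢ univ] ((0 : ℝ), (0 : ℝ)),
        d.Lam p.1 p.2 ≤ (1 + ε) * d.Lam 0 0 :=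
      (hd.continuousOn_Lam (0, 0) (by simp)).eventually_le_const (by nlinarith)
    rw [nhdsWithin_prod_eq, nhdsWithin_univ, eventually_prod_iff] at h1
    obtain ⟨P, hP, Q, hQ, hPQ⟩ := h1
    rw [nhdsWithin_Icc_eq_nhdsGE zero_lt_one] at hP
    obtain ⟨b, hb, hPb⟩ := exists_Icc_of_eventually hP
    obtain ⟨b', hb', hQb⟩ := exists_Icc_of_eventually (nhdsWithin_le_nhds hQ)
    have h2 : ∀ᶠ R in 𝓝[≥] (0 : ℝ), d.yCH R ≤ b := hd.tendsto_yCH.eventually_le_const hb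
    obtain ⟨a, ha, h3⟩ := exists_Icc_of_eventually
      ((hd.eventually_le_yCH_pow hε).and (h2.and (Icc_mem_nhdsGE hb')))
    refine ⟨a, ha, fun R hR => ⟨(h3 R hR).1, fun R' hR' w hw => ?_⟩⟩
    exact hPQ (hPb w ⟨hw.1, hw.2.trans (h3 R hR).2.1⟩)
      (hQb R' ⟨hR'.1, hR'.2.trans (h3 R hR).2.2.2⟩)
  choose! F hF0 hF using key
  -- The chosen `F` need not tend to `0`; the minimum with `ε` forces this, and shrinking the radius
  -- preserves both bounds.
  have hpos : ∀ ε : ℝ, 0 < ε → 0 < min (F ε) ε := fun ε hε => lt_min (hF0 ε hε) hε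
  have hlim : Tendsto (fun ε => min (F ε) ε) (𝓝[>] 0) (𝓝[≥] 0) := by
    refine tendsto_nhdsWithin_iff.2 ⟨?_, ?_⟩
    · refine tendsto_of_tendsto_of_tendsto_of_le_of_le' tendsto_const_nhds
        (tendsto_nhdsWithin_of_tendsto_nhds tendsto_id)
        (eventually_mem_nhdsWithin.mono fun ε hε => (hpos ε hε).le)
        (Eventually.of_forall fun ε => min_le_right _ _)
    · exact eventually_mem_nhdsWithin.mono fun ε hε => (hpos ε hε).le
  refine ⟨fun ε => min (F ε) ε, ⟨fun ε hε => hpos ε hε.1, fun ε hε R hR => ?_,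
    fun ε hε R hR w hw => ?_, hlim.mono_right nhdsWithin_le_nhds, hd.tendsto_yCH.comp hlim⟩⟩
  · exact (hF ε hε.1 R ⟨hR.1, hR.2.trans (min_le_left _ _)⟩).1
  · exact (hF ε hε.1 _ ⟨(hpos ε hε.1).le, min_le_left _ _⟩).2 R hR w hw

/-- Global nakedness bounds the Cauchy horizon away from the singularity inside the cloud. -/
lemma Admissible.exists_le_yCH_pow (hd : d.Admissible) (hn : d.GloballyNaked) :
    ∃ κ > 0, ∀ R ∈ Icc 0 d.R₁, κ * R ^ 2 ≤ d.yCH R ^ 3 := by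
  have hΛ := hd.Lam_zero_pos
  have hR₁ := hd.R₁_pos
  obtain ⟨a, ha, h⟩ := exists_Icc_of_eventually
    (hd.eventually_le_yCH_pow (ε := 1 / 2) (by norm_num))
  -- Without such a ray `y_CH(R₁)` would be the supremum of the empty set, namely `0`, contradicting
  -- nakedness since `m(R₁) > 0`.
  have hne : ∃ T, d.IsRayFromSingularity T d.R₁ := by
    by_contra! hno
    have : d.yCH d.R₁ = 0 := by simp [yCH, hno]
    rw [GloballyNaked, this, two_m_eq] at hn
    have := mul_pos (hd.c_pos d.R₁) (pow_pos hR₁ 3)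
    linarith
  obtain ⟨T, hT⟩ := hne
  have hcont : ContinuousOn (fun R => d.y (T R) R) (Icc a d.R₁) := by
    intro R hR
    have hR' : R ∈ Ioc 0 d.R₁ := ⟨ha.trans_le hR.1, hR.2⟩
    have hm := hT.mem R hR'
    exact (hd.hasDerivWithinAt_y (hd.phase_mem hm.1 hm.2) (hT.ode R hR')).continuousWithinAt.mono
      fun x hx => ⟨ha.trans_le hx.1, hx.2⟩
  have hpos : ∃ δ > 0, ∀ R ∈ Icc a d.R₁, δ ≤ d.yCH R := by
    rcases (Icc a d.R₁).eq_empty_or_nonempty with he | hne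
    · exact ⟨1, one_pos, by simp [he]⟩
    · obtain ⟨x, hx, hmin⟩ := isCompact_Icc.exists_isMinOn hne hcont
      have hm := hT.mem x ⟨ha.trans_le hx.1, hx.2⟩
      exact ⟨_, (hd.y_mem hm.1 hm.2).1, fun R hR => (hmin hR).trans
        (hd.y_le_yCH (ha.trans_le hR.1) (hT.mono hR.2))⟩
  obtain ⟨δ, hδ, hδR⟩ := hpos
  -- The first entry is the asymptotic bound with `ε = 1/2`, valid on `[0, a]`; the second comes
  -- from the positive minimum `δ` of one ray on the compact rest.
  refine ⟨min (3 * d.Lam 0 0 / 8) (δ ^ 3 / d.R₁ ^ 2), lt_min (by positivity) (by positivity),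
    fun R hR => ?_⟩
  rcases le_total R a with hRa | hRa
  · refine le_trans ?_ (h R ⟨hR.1, hRa⟩)
    have := min_le_left (3 * d.Lam 0 0 / 8) (δ ^ 3 / d.R₁ ^ 2)
    nlinarith [sq_nonneg R]
  · calc _ ≤ δ ^ 3 / d.R₁ ^ 2 * d.R₁ ^ 2 := by
          refine mul_le_mul (min_le_right _ _) (pow_le_pow_left₀ hR.1 hR.2 2) (sq_nonneg _)
            (by positivity)
      _ = δ ^ 3 := by field_simp
      _ ≤ _ := pow_le_pow_left₀ hδ.le (hδR R ⟨hRa, hR.2⟩) 3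

end InitialData

/-- Integration of the bound `|L'| ≤ C |w'| w^{-2/3}`. -/
lemma abs_sub_le_of_deriv_le_cbrt {a b C ρ : ℝ} (hab : a ≤ b) (hC : 0 ≤ C) {w w' L l : ℝ → ℝ}
    (hwc : ContinuousOn w (Icc a b)) (hLc : ContinuousOn L (Icc a b))
    (hwρ : ∀ s ∈ Icc a b, 0 ≤ w s ∧ w s ≤ ρ) (hw0 : ∀ s ∈ Ioo a b, 0 < w s)
    (hw : ∀ s ∈ Ioo a b, HasDerivAt w (w' s) s) (hw' : ∀ s ∈ Ioo a b, w' s ≠ 0)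
    (hL : ∀ s ∈ Ioo a b, HasDerivAt L (l s) s)
    (hl : ∀ s ∈ Ioo a b, |l s| ≤ C * |w' s| / cbrt (w s) ^ 2) :
    |L b - L a| ≤ 3 * C * cbrt ρ := by
  have hcb := continuous_cbrt
  have hcw : ContinuousOn (fun s => cbrt (w s)) (Icc a b) := hcb.comp_continuousOn hwc
  have hder : ∀ σ : ℝ, ∀ s ∈ Ioo a b, HasDerivAt (fun s => 3 * C * cbrt (w s) + σ * L s)
      (C * w' s / cbrt (w s) ^ 2 + σ * l s) s := by
    intro σ s hs
    refine (((((hasDerivAt_cbrt (hw0 s hs)).comp s (hw s hs)).const_mul (3 * C))).add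
      ((hL s hs).const_mul σ)).congr_deriv ?_
    have := cbrt_pos (hw0 s hs)
    field_simp
  have hcont : ∀ σ : ℝ, ContinuousOn (fun s => 3 * C * cbrt (w s) + σ * L s) (Icc a b) := by
    intro σ; fun_prop
  have ha : a ∈ Icc a b := left_mem_Icc.2 hab
  have hb : b ∈ Icc a b := right_mem_Icc.2 hab
  have hba : 0 ≤ cbrt (w a) ∧ cbrt (w a) ≤ cbrt ρ :=
    ⟨cbrt_nonneg (hwρ a ha).1, cbrt_le_cbrt (hwρ a ha).1 (hwρ a ha).2⟩
  have hbb : 0 ≤ cbrt (w b) ∧ cbrt (w b) ≤ cbrt ρ :=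
    ⟨cbrt_nonneg (hwρ b hb).1, cbrt_le_cbrt (hwρ b hb).1 (hwρ b hb).2⟩
  rw [abs_le]
  -- By Darboux, the nonvanishing `w'` has constant sign. Then `3C w^(1/3) + L` and `3C w^(1/3) - L`
  -- are both monotone in the direction of `w`, which bounds the change of `L`.
  rcases hasDerivWithinAt_forall_lt_or_forall_gt_of_forall_ne (convex_Ioo a b)
    (fun s hs => (hw s hs).hasDerivWithinAt) hw' with hsgn | hsgn
  · have hanti : ∀ σ : ℝ, |σ| = 1 →
        AntitoneOn (fun s => 3 * C * cbrt (w s) + σ * L s) (Icc a b) := by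
      intro σ hσ
      refine antitoneOn_of_hasDerivWithinAt_nonpos (convex_Icc a b) (hcont σ)
        (fun s hs => (hder σ s (by rwa [interior_Icc] at hs)).hasDerivWithinAt) fun s hs => ?_
      rw [interior_Icc] at hs
      have h1 := hl s hs
      rw [abs_of_neg (hsgn s hs), mul_neg, neg_div] at h1
      have h2 : σ * l s ≤ |l s| := (le_abs_self _).trans_eq (by rw [abs_mul, hσ, one_mul])
      linarith
    have h1 := hanti 1 (by simp) ha hb hab
    have h2 := hanti (-1) (by simp) ha hb hab
    simp only at h1 h2
    constructor <;> nlinarith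
  · have hmono : ∀ σ : ℝ, |σ| = 1 →
        MonotoneOn (fun s => 3 * C * cbrt (w s) + σ * L s) (Icc a b) := by
      intro σ hσ
      refine monotoneOn_of_hasDerivWithinAt_nonneg (convex_Icc a b) (hcont σ)
        (fun s hs => (hder σ s (by rwa [interior_Icc] at hs)).hasDerivWithinAt) fun s hs => ?_
      rw [interior_Icc] at hs
      have h1 := hl s hs
      rw [abs_of_pos (hsgn s hs)] at h1
      have h2 : -|l s| ≤ σ * l s := by
        have := neg_abs_le (σ * l s)
        rwa [abs_mul, hσ, one_mul] at this
      linarith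
    have h1 := hmono 1 (by simp) ha hb hab
    have h2 := hmono (-1) (by simp) ha hb hab
    simp only at h1 h2
    constructor <;> nlinarith

namespace InitialData

variable {d : InitialData}

/-! ### The rate of change of the frequency along radial null geodesics -/

/-- `-∂(1/γ)/∂τ` as a function of `(y, R)`; it is the logarithmic derivative of the frequency of a
radial light signal with respect to `|R|`. -/
def shiftRate (d : InitialData) (y R : ℝ) : ℝ := d.dStretch y R * d.speed y R / d.energy R

lemma Admissible.apply_abs (_hd : d.Admissible) {F : ℝ → ℝ} (hF : ∀ R, F (-R) = F R) (R : ℝ) :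
    F |R| = F R := by
  rcases abs_choice R with h | h <;> rw [h]
  exact hF R

lemma Admissible.phase_abs (hd : d.Admissible) (τ R : ℝ) : d.phase τ |R| = d.phase τ R := by
  unfold phase
  rw [hd.apply_abs hd.q_neg, hd.apply_abs hd.c_neg]

lemma Admissible.y_abs (hd : d.Admissible) (τ R : ℝ) : d.y τ |R| = d.y τ R := by
  rw [y_eq, y_eq, hd.phase_abs, hd.apply_abs hd.q_neg]

lemma Admissible.shiftRate_abs (hd : d.Admissible) (y R : ℝ) :
    d.shiftRate y |R| = d.shiftRate y R := by
  unfold shiftRate dStretch speed root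
  rw [hd.apply_abs hd.q_neg, hd.apply_abs hd.c_neg, hd.apply_abs hd.energy_neg,
    hd.apply_abs (hd.Lam_neg y), hd.apply_abs (hd.dLam_neg y), sq_abs]

lemma Admissible.stretch_pos (hd : d.Admissible) {y R : ℝ} (hy : y ∈ Ioc (0 : ℝ) 1) :
    0 < d.stretch y R := by
  have h1 := hd.Lam_nonneg (abs_nonneg R) (Ioc_subset_Icc_self hy)
  rw [hd.apply_abs (hd.Lam_neg y)] at h1
  have h2 := hd.root_pos (R := R) (Ioc_subset_Icc_self hy)
  have := hy.1
  unfold stretch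
  positivity

lemma ip_eq (d : InitialData) {p v w : Fin 4 → ℝ} (h2 : w 2 = 0) (h3 : w 3 = 0) :
    d.ip p v w = -(v 0 * w 0) + 1 / d.γ (p 0) (p 1) ^ 2 * v 1 * w 1 := by
  simp [ip, metric, Fin.sum_univ_four, h2, h3]

lemma sum_dmetric_eq (d : InitialData) {p v : Fin 4 → ℝ} (h2 : v 2 = 0) (h3 : v 3 = 0) :
    ∑ b, ∑ c, d.dmetric p 0 b c * v b * v c =
      deriv (fun t => 1 / d.γ t (p 1) ^ 2) (p 0) * v 1 ^ 2 := by
  simp [dmetric, metric, Fin.sum_univ_four, h2, h3]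
  ring

lemma metric_zero_sum (d : InitialData) (p v : Fin 4 → ℝ) :
    ∑ b, d.metric p 0 b * v b = -v 0 := by
  simp [metric, Fin.sum_univ_four]

/-- Since `g_ττ = -1` and the angular velocities vanish, the `τ`-component reads `-(ξ⁰)' = ½
∂_τ(γ⁻²) (ξ¹)²`. Nullity gives `ξ⁰ = |ξ¹|/γ`, which trades one factor `|ξ¹|/γ` for `ξ⁰` and also
shows `ξ¹ ≠ 0`. -/
lemma Admissible.geodesic_equations (hd : d.Admissible) {x ξ : ℝ → Fin 4 → ℝ} {s₁ s₂ : ℝ}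
    (hx : d.IsRadialNullGeodesic x ξ s₁ s₂) (hrun : RunsIn x s₁ s₂ d.D) {s : ℝ}
    (hs : s ∈ Icc s₁ s₂) :
    d.ip (x s) u (ξ s) = -ξ s 0 ∧ 0 < ξ s 0 ∧ ξ s 1 ≠ 0 ∧
      HasDerivWithinAt (fun t => x t 1) (ξ s 1) (Icc s₁ s₂) s ∧
      HasDerivWithinAt (fun t => ξ t 0)
        (d.shiftRate (d.y (x s 0) |x s 1|) |x s 1| * |ξ s 1| * ξ s 0) (Icc s₁ s₂) s := by
  obtain ⟨ϑ, φ, -, -, hrad⟩ := hx.radial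
  obtain ⟨-, -, h2, h3⟩ := hrad s hs
  have hfut := hx.future s hs
  have hnull := hx.null s hs
  obtain ⟨hgx, hgξ⟩ := hx.geodesic s hs
  obtain ⟨-, ht0, hts, -⟩ := hrun s hs
  have hp := hd.phase_mem ht0 hts
  have hy := hd.y_mem ht0 hts
  rw [hd.phase_abs] at hp
  rw [hd.y_abs] at hy
  have hip : d.ip (x s) u (ξ s) = -ξ s 0 := by rw [ip_eq d h2 h3]; simp [u]
  rw [hip] at hfut
  have hN : 0 < ξ s 0 := by linarith
  have hΓ : 0 < 1 / d.γ (x s 0) (x s 1) := by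
    rw [hd.one_div_γ hp]
    exact div_pos (hd.stretch_pos hy) (hd.energy_pos _)
  rw [ip_eq d h2 h3, ← one_div_pow] at hnull
  have habs : 1 / d.γ (x s 0) (x s 1) * |ξ s 1| = ξ s 0 := by
    have h1 : (1 / d.γ (x s 0) (x s 1) * |ξ s 1|) ^ 2 = ξ s 0 ^ 2 := by
      rw [mul_pow, sq_abs]; linarith
    exact (pow_left_inj₀ (by positivity) hN.le two_ne_zero).1 h1
  have hξ1 : ξ s 1 ≠ 0 := by
    intro h0
    rw [h0, abs_zero, mul_zero] at habs
    exact hN.ne habs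
  refine ⟨hip, hN, hξ1, hasDerivWithinAt_pi.1 hgx 1, ?_⟩
  have h4 := hgξ 0
  simp only [metric_zero_sum] at h4
  rw [sum_dmetric_eq d h2 h3, (hd.hasDerivAt_inv_γ_sq hp).deriv] at h4
  have h5 := h4.neg
  simp only at h5
  refine (h5.congr_of_eventuallyEq (f₁ := fun t => ξ t 0) (Eventually.of_forall fun t => by simp)
    (by simp)).congr_deriv ?_
  rw [hd.y_abs, hd.shiftRate_abs, ← habs, ← sq_abs (ξ s 1), shiftRate]
  ring

lemma Admissible.redshift_eq (hd : d.Admissible) {x ξ : ℝ → Fin 4 → ℝ} {s₁ s₂ : ℝ} (h : s₁ ≤ s₂)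
    (hx : d.IsRadialNullGeodesic x ξ s₁ s₂) (hrun : RunsIn x s₁ s₂ d.D) :
    d.redshift x ξ s₁ s₂ = ξ s₁ 0 / ξ s₂ 0 - 1 := by
  rw [redshift, (hd.geodesic_equations hx hrun (left_mem_Icc.2 h)).1,
    (hd.geodesic_equations hx hrun (right_mem_Icc.2 h)).1, neg_div_neg_eq]

/-! ### Bounds for the frequency shift -/

lemma shiftRate_eq (d : InitialData) {y R : ℝ} (hy : y ≠ 0) (hS : d.root y R ≠ 0) :
    d.shiftRate y R = √(d.c R) / d.energy R / 2 * (2 * d.root y R - R ^ 2 / y ^ 3 * d.Lam y R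
      + R ^ 2 / y ^ 3 * d.dLam y R * d.root y R ^ 2 * y) / y := by
  unfold shiftRate dStretch speed
  field_simp

/-- In the form `shiftRate_eq`, the bound `R²/y³ ≤ 1/κ` controls the bracket, and the remaining
factor `1/y` is at most `κ^(-1/3) R^(-2/3)`. -/
lemma Admissible.exists_abs_shiftRate_le (hd : d.Admissible) (hn : d.GloballyNaked) :
    ∃ C : ℝ, 0 ≤ C ∧ ∀ R ∈ Ioc 0 d.R₁, ∀ y ∈ Ioc (0 : ℝ) 1, d.yCH R < y →
      |d.shiftRate y R| ≤ C / cbrt R ^ 2 := by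
  obtain ⟨κ, hκ, hCH⟩ := hd.exists_le_yCH_pow hn
  have hcompact : IsCompact (Icc (0 : ℝ) 1 ×ˢ Icc 0 d.R₁) := isCompact_Icc.prod isCompact_Icc
  have h00 : ((0 : ℝ), (0 : ℝ)) ∈ Icc (0 : ℝ) 1 ×ˢ Icc 0 d.R₁ := by simp [hd.R₁_pos.le]
  obtain ⟨M, hM⟩ := hcompact.exists_bound_of_continuousOn
    (hd.continuousOn_Lam.mono (prod_mono_right (subset_univ _)))
  obtain ⟨M', hM'⟩ := hcompact.exists_bound_of_continuousOn
    (hd.continuousOn_dLam.mono (prod_mono_right (subset_univ _)))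
  have hAc : Continuous fun R => √(d.c R) / d.energy R := by
    have := hd.continuous_c
    exact (by fun_prop : Continuous fun R => √(d.c R)).div hd.continuous_energy
      fun R => (hd.energy_pos R).ne'
  obtain ⟨A, hA⟩ := (isCompact_Icc (a := 0) (b := d.R₁)).exists_bound_of_continuousOn
    hAc.continuousOn
  have hM0 : 0 ≤ M := (norm_nonneg _).trans (hM _ h00)
  have hM0' : 0 ≤ M' := (norm_nonneg _).trans (hM' _ h00)
  have hA0 : 0 ≤ A := (norm_nonneg _).trans (hA 0 h00.2)
  refine ⟨A / 2 * (2 + M / κ + M' / κ) / cbrt κ, ?_, fun R hR y hy hyCH => ?_⟩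
  · have := cbrt_pos hκ
    positivity
  have hR0 := hR.1
  have hy0 := hy.1
  have hRc := Ioc_subset_Icc_self hR
  have hyc := Ioc_subset_Icc_self hy
  have hS := hd.root_pos (R := R) hyc
  have hS1 := root_le_one (d := d) (y := y) (R := R)
  have hy3 : κ * R ^ 2 ≤ y ^ 3 :=
    (hCH R hRc).trans (pow_le_pow_left₀ (hd.yCH_nonneg R) hyCH.le 3)
  have hquot : R ^ 2 / y ^ 3 ≤ 1 / κ := by
    rw [div_le_div_iff₀ (by positivity) hκ]; linarith
  have hq0 : 0 ≤ R ^ 2 / y ^ 3 := by positivity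
  have hL : |d.Lam y R| ≤ M := hM (y, R) ⟨hyc, hRc⟩
  have hL' : |d.dLam y R| ≤ M' := hM' (y, R) ⟨hyc, hRc⟩
  have hAR : |√(d.c R) / d.energy R| ≤ A := hA R hRc
  have hroot : cbrt κ * cbrt R ^ 2 ≤ y := by
    refine le_of_pow_le_pow_left₀ three_ne_zero hy0.le ?_
    calc (cbrt κ * cbrt R ^ 2) ^ 3 = cbrt κ ^ 3 * (cbrt R ^ 3) ^ 2 := by ring
      _ = κ * R ^ 2 := by rw [cbrt_pow hκ.le, cbrt_pow hR0.le]
      _ ≤ y ^ 3 := hy3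
  have hpos : 0 < cbrt κ * cbrt R ^ 2 := mul_pos (cbrt_pos hκ) (pow_pos (cbrt_pos hR0) 2)
  have hb : |2 * d.root y R - R ^ 2 / y ^ 3 * d.Lam y R
      + R ^ 2 / y ^ 3 * d.dLam y R * d.root y R ^ 2 * y| ≤ 2 + M / κ + M' / κ := by
    refine (abs_add_le _ _).trans (add_le_add ((abs_sub _ _).trans (add_le_add ?_ ?_)) ?_)
    · rw [abs_of_nonneg (by positivity)]; linarith
    · rw [abs_mul, abs_of_nonneg hq0]
      calc _ ≤ 1 / κ * M := mul_le_mul hquot hL (abs_nonneg _) (by positivity)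
        _ = M / κ := by ring
    · rw [mul_assoc, abs_mul, abs_mul, abs_of_nonneg hq0,
        abs_of_nonneg (show 0 ≤ d.root y R ^ 2 * y by positivity)]
      have h1 : d.root y R ^ 2 * y ≤ 1 :=
        mul_le_one₀ (pow_le_one₀ hS.le hS1) hy0.le hy.2
      calc _ ≤ 1 / κ * M' * 1 := mul_le_mul
              (mul_le_mul hquot hL' (abs_nonneg _) (by positivity)) h1 (by positivity)
              (by positivity)
        _ = M' / κ := by ring
  rw [shiftRate_eq d hy0.ne' hS.ne', abs_div, abs_mul, abs_div, abs_two, abs_of_pos hy0, div_div]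
  refine div_le_div₀ (by positivity) ?_ hpos hroot
  exact mul_le_mul (by linarith) hb (abs_nonneg _) (by positivity)

/-- After multiplication of `∂_y` of the stretch by `y²`, the term `2y³` exceeds `1.485 R² Λ₀`. For
`y ≤ 2/5` the root is at least `9/10`, so the negative `Λ` term is at most `1.01/0.9 < 9/8` times
`R² Λ₀`, and the `∂_yΛ` term costs at most `R² Λ₀/100`. -/
lemma Admissible.shiftRate_pos (hd : d.Admissible) {y R M ε : ℝ} (hy0 : 0 < y) (hy1 : y ≤ 2 / 5)
    (hε : ε ≤ 1 / 100) (hM : |d.dLam y R| ≤ M)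
    (hMy : M * y ≤ d.Lam 0 0 / 100) (hL : d.Lam y R ≤ (1 + ε) * d.Lam 0 0)
    (hCH : 3 * d.Lam 0 0 / 4 * R ^ 2 * (1 - ε) < y ^ 3) : 0 < d.shiftRate y R := by
  have hΛ := hd.Lam_zero_pos
  have hq := hd.q_pos R
  have hq1 := hd.q_lt_one R
  have hS1 := root_le_one (d := d) (y := y) (R := R)
  have hS : 9 / 10 ≤ d.root y R := by
    refine Real.le_sqrt_of_sq_le ?_
    have : d.q R ^ 2 ≤ 1 := pow_le_one₀ hq.le hq1.le
    nlinarith [sq_nonneg y]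
  have hS0 : 0 < d.root y R := by linarith
  have h1 : R ^ 2 * d.Lam y R / d.root y R ≤ R ^ 2 * (d.Lam 0 0 * (9 / 8)) := by
    rw [mul_div_assoc]
    refine mul_le_mul_of_nonneg_left ?_ (sq_nonneg _)
    rw [div_le_iff₀ hS0]
    nlinarith
  have h2 : -(R ^ 2 * (d.Lam 0 0 / 100)) ≤ R ^ 2 * (d.dLam y R * d.root y R * y) := by
    rw [← mul_neg]
    refine mul_le_mul_of_nonneg_left ?_ (sq_nonneg _)
    have h3 : |d.dLam y R * d.root y R * y| ≤ M * y := by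
      rw [abs_mul, abs_mul, abs_of_pos hS0, abs_of_pos hy0]
      refine mul_le_mul_of_nonneg_right ?_ hy0.le
      nlinarith [abs_nonneg (d.dLam y R)]
    linarith [neg_abs_le (d.dLam y R * d.root y R * y)]
  have h4 : d.dStretch y R = (2 * y ^ 3 - R ^ 2 * d.Lam y R / d.root y R
      + R ^ 2 * (d.dLam y R * d.root y R * y)) / y ^ 2 := by
    unfold dStretch
    field_simp
  have h5 : 0 ≤ R ^ 2 * d.Lam 0 0 := by positivity
  have h6 : 0 < d.dStretch y R := by
    rw [h4]
    refine div_pos ?_ (by positivity)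
    nlinarith
  have := hd.sqrt_c_pos R
  have := hd.energy_pos R
  unfold shiftRate speed
  positivity

end InitialData

/-! ### Bounded redshift and blueshift near the singularity -/

open InitialData in
theorem log_frequency_bound {d : InitialData} (hd : d.Admissible) (hn : d.GloballyNaked) :
    ∃ K : ℝ, ∀ (x ξ : ℝ → Fin 4 → ℝ) (s₁ s₂ : ℝ), s₁ ≤ s₂ →
      d.IsRadialNullGeodesic x ξ s₁ s₂ → RunsIn x s₁ s₂ {p ∈ d.D | p.2 ≤ d.R₁} →
      |Real.log (ξ s₂ 0) - Real.log (ξ s₁ 0)| ≤ K := by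
  obtain ⟨C, hC, hbound⟩ := hd.exists_abs_shiftRate_le hn
  -- Each piece on which `R ≠ 0` in the interior contributes at most `3C R₁^(1/3)`, and a passage
  -- through the centre makes two pieces.
  refine ⟨2 * (3 * C * cbrt d.R₁), fun x ξ s₁ s₂ h12 hx hrun => ?_⟩
  have hrunD : RunsIn x s₁ s₂ d.D := fun s hs => (hrun s hs).1
  have heq := fun s (hs : s ∈ Icc s₁ s₂) => hd.geodesic_equations hx hrunD hs
  have hwc : ContinuousOn (fun s => x s 1) (Icc s₁ s₂) :=
    fun s hs => (heq s hs).2.2.2.1.continuousWithinAt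
  have hLder : ∀ s ∈ Icc s₁ s₂, HasDerivWithinAt (fun s => Real.log (ξ s 0))
      (d.shiftRate (d.y (x s 0) |x s 1|) |x s 1| * |ξ s 1|) (Icc s₁ s₂) s := by
    intro s hs
    have hN := (heq s hs).2.1
    refine ((heq s hs).2.2.2.2.log hN.ne').congr_deriv ?_
    field_simp
  have hpiece : ∀ a b, s₁ ≤ a → a ≤ b → b ≤ s₂ → (∀ s ∈ Ioo a b, x s 1 ≠ 0) →
      |Real.log (ξ b 0) - Real.log (ξ a 0)| ≤ 3 * C * cbrt d.R₁ := by
    intro a b ha hab hb hne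
    have hsub : Icc a b ⊆ Icc s₁ s₂ := Icc_subset_Icc ha hb
    have hnhds : ∀ s ∈ Ioo a b, Icc s₁ s₂ ∈ 𝓝 s := fun s hs =>
      Icc_mem_nhds (ha.trans_lt hs.1) (hs.2.trans_le hb)
    have hin : ∀ s ∈ Ioo a b, s ∈ Icc s₁ s₂ := fun s hs => hsub (Ioo_subset_Icc_self hs)
    refine abs_sub_le_of_deriv_le_cbrt (w := fun s => |x s 1|)
      (w' := fun s => (SignType.sign (x s 1) : ℝ) * ξ s 1) hab hC (hwc.mono hsub).abs
      (fun s hs => ((hLder s (hsub hs)).continuousWithinAt).mono hsub)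
      (fun s hs => ⟨abs_nonneg _, (hrun s (hsub hs)).2⟩) (fun s hs => abs_pos.2 (hne s hs))
      (fun s hs => HasDerivAt.comp (h₂ := fun z => |z|) (h := fun t => x t 1) s
        (hasDerivAt_abs (hne s hs)) ((heq s (hin s hs)).2.2.2.1.hasDerivAt (hnhds s hs)))
      (fun s hs => mul_ne_zero ?_ (heq s (hin s hs)).2.2.1)
      (fun s hs => (hLder s (hin s hs)).hasDerivAt (hnhds s hs)) fun s hs => ?_
    · rcases (hne s hs).lt_or_gt with h | h <;> simp [h]
    · obtain ⟨⟨-, ht0, hts, hyCH⟩, hR₁⟩ := hrun s (hin s hs)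
      have h1 := hbound |x s 1| ⟨abs_pos.2 (hne s hs), hR₁⟩ _ (hd.y_mem ht0 hts) hyCH
      have h2 : |(SignType.sign (x s 1) : ℝ) * ξ s 1| = |ξ s 1| := by
        rcases (hne s hs).lt_or_gt with h | h <;> simp [h]
      rw [h2, abs_mul, abs_abs, mul_div_right_comm]
      exact mul_le_mul_of_nonneg_right h1 (abs_nonneg _)
  have hK : 0 ≤ 3 * C * cbrt d.R₁ := by
    have := cbrt_pos hd.R₁_pos
    positivity
  by_cases hz : ∃ s₀ ∈ Icc s₁ s₂, x s₀ 1 = 0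
  · obtain ⟨s₀, hs₀, h0⟩ := hz
    -- As `ξ¹ ≠ 0`, the signed radius is strictly monotone and vanishes only at `s₀`.
    have hinj : InjOn (fun s => x s 1) (Icc s₁ s₂) := by
      have hint : ∀ s ∈ interior (Icc s₁ s₂), HasDerivWithinAt (fun s => x s 1) (ξ s 1)
          (interior (Icc s₁ s₂)) s := fun s hs =>
        (heq s (interior_subset hs)).2.2.2.1.mono interior_subset
      rcases hasDerivWithinAt_forall_lt_or_forall_gt_of_forall_ne (convex_Icc s₁ s₂)
        (fun s hs => (heq s hs).2.2.2.1) (fun s hs => (heq s hs).2.2.1) with h | h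
      · exact (strictAntiOn_of_hasDerivWithinAt_neg (convex_Icc _ _) hwc hint
          fun s hs => h s (interior_subset hs)).injOn
      · exact (strictMonoOn_of_hasDerivWithinAt_pos (convex_Icc _ _) hwc hint
          fun s hs => h s (interior_subset hs)).injOn
    have h1 := hpiece s₁ s₀ le_rfl hs₀.1 hs₀.2 fun s hs h =>
      hs.2.ne (hinj ⟨hs.1.le, hs.2.le.trans hs₀.2⟩ hs₀ (h.trans h0.symm))
    have h2 := hpiece s₀ s₂ hs₀.1 hs₀.2 le_rfl fun s hs h =>
      hs.1.ne' (hinj ⟨hs₀.1.trans hs.1.le, hs.2.le⟩ hs₀ (h.trans h0.symm))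
    have h3 := abs_sub_le (Real.log (ξ s₂ 0)) (Real.log (ξ s₀ 0)) (Real.log (ξ s₁ 0))
    linarith
  · have h1 := hpiece s₁ s₂ le_rfl h12 le_rfl fun s hs h => hz ⟨s, Ioo_subset_Icc_self hs, h⟩
    linarith

open InitialData in
theorem redshift_bound {d : InitialData} (hd : d.Admissible) (hn : d.GloballyNaked) :
    ∃ C : ℝ, ∀ (x ξ : ℝ → Fin 4 → ℝ) (s_e s_o : ℝ), s_e ≤ s_o →
      d.IsRadialNullGeodesic x ξ s_e s_o → RunsIn x s_e s_o {p ∈ d.D | p.2 ≤ d.R₁} →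
      |d.redshift x ξ s_e s_o| ≤ C := by
  obtain ⟨K, hK⟩ := log_frequency_bound hd hn
  refine ⟨Real.exp K + 1, fun x ξ s₁ s₂ h12 hx hrun => ?_⟩
  have hrunD : RunsIn x s₁ s₂ d.D := fun s hs => (hrun s hs).1
  have h1 := (hd.geodesic_equations hx hrunD (left_mem_Icc.2 h12)).2.1
  have h2 := (hd.geodesic_equations hx hrunD (right_mem_Icc.2 h12)).2.1
  have h3 : ξ s₁ 0 / ξ s₂ 0 ≤ Real.exp K := by
    rw [← Real.log_le_iff_le_exp (div_pos h1 h2), Real.log_div h1.ne' h2.ne']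
    linarith [(abs_le.1 (hK x ξ s₁ s₂ h12 hx hrun)).1]
  have h4 := div_pos h1 h2
  rw [hd.redshift_eq h12 hx hrunD, abs_le]
  constructor <;> linarith [Real.exp_pos K]

open InitialData in
-- For small `ε` the region lies where `shiftRate_pos` applies, so `ξ⁰` strictly increases along
-- every signal, whichever way it runs. At the centre the rate is positive as well, so crossing it
-- needs no separate argument.
theorem eventually_blueshift {d : InitialData} (hd : d.Admissible) {Rf : ℝ → ℝ}
    (hR : d.IsRegionFamily Rf) :
    ∀ᶠ ε in 𝓝[>] (0 : ℝ), ∀ (x ξ : ℝ → Fin 4 → ℝ) (s_e s_o : ℝ), s_e < s_o →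
      d.IsRadialNullGeodesic x ξ s_e s_o → RunsIn x s_e s_o (d.DR (Rf ε)) →
      d.redshift x ξ s_e s_o < 0 := by
  have hΛ := hd.Lam_zero_pos
  obtain ⟨M, hM⟩ := (isCompact_Icc.prod isCompact_Icc).exists_bound_of_continuousOn
    (hd.continuousOn_dLam.mono (prod_mono_right (subset_univ (Icc (0 : ℝ) 1))))
  have hM0 : 0 ≤ M := (norm_nonneg _).trans (hM (0, 0) (by simp))
  have hMy : Tendsto (fun ε => M * d.yCH (Rf ε)) (𝓝[>] 0) (𝓝 0) := by
    simpa using hR.tendsto_y.const_mul M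
  filter_upwards [Ioo_mem_nhdsGT (show (0 : ℝ) < 1 / 100 by norm_num),
    hR.tendsto_R.eventually_le_const zero_lt_one,
    hR.tendsto_y.eventually_le_const (show (0 : ℝ) < 2 / 5 by norm_num),
    hMy.eventually_le_const (show 0 < d.Lam 0 0 / 100 by positivity)] with ε hε hR1 hy1 hMy1
  intro x ξ s₁ s₂ h12 hx hrun
  have hrunD : RunsIn x s₁ s₂ d.D := fun s hs => (hrun s hs).1
  have hε1 : ε ∈ Ioo (0 : ℝ) 1 := ⟨hε.1, hε.2.trans (by norm_num)⟩
  have hmono : StrictMonoOn (fun s => ξ s 0) (Icc s₁ s₂) := by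
    refine strictMonoOn_of_hasDerivWithinAt_pos (convex_Icc s₁ s₂)
      (fun s hs => (hd.geodesic_equations hx hrunD hs).2.2.2.2.continuousWithinAt)
      (fun s hs => (hd.geodesic_equations hx hrunD
        (interior_subset hs)).2.2.2.2.mono interior_subset) fun s hs => ?_
    replace hs := interior_subset hs
    obtain ⟨-, hN, hξ, -⟩ := hd.geodesic_equations hx hrunD hs
    obtain ⟨⟨hR0, ht0, hts, hyCH⟩, hRR, hyy⟩ := hrun s hs
    simp only at hR0 ht0 hts hyCH hRR hyy
    have hy := hd.y_mem ht0 hts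
    have hpos : 0 < d.shiftRate (d.y (x s 0) |x s 1|) |x s 1| := by
      refine hd.shiftRate_pos hy.1 (hyy.trans hy1) hε.2.le
        (hM (_, _) ⟨Ioc_subset_Icc_self hy, hR0, hRR.trans hR1⟩)
        ((mul_le_mul_of_nonneg_left hyy hM0).trans hMy1)
        (hR.upper ε hε1 _ ⟨hR0, hRR⟩ _ ⟨hy.1.le, hyy⟩) ?_
      exact (hR.lower ε hε1 _ ⟨hR0, hRR⟩).trans_lt
        (pow_lt_pow_left₀ hyCH (hd.yCH_nonneg _) three_ne_zero)
    have := abs_pos.2 hξ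
    positivity
  have h2 := (hd.geodesic_equations hx hrunD (right_mem_Icc.2 h12.le)).2.1
  rw [hd.redshift_eq h12.le hx hrunD, sub_neg, div_lt_one h2]
  exact hmono (left_mem_Icc.2 h12.le) (right_mem_Icc.2 h12.le) h12

end TolmanBondi

end

theorem proposition1 (d : TolmanBondi.InitialData) (hd : d.Admissible)
    (hnaked : d.GloballyNaked) :
    (∃ C : ℝ, ∀ (x ξ : ℝ → Fin 4 → ℝ) (s_e s_o : ℝ), s_e ≤ s_o →
      d.IsRadialNullGeodesic x ξ s_e s_o →
      TolmanBondi.InitialData.RunsIn x s_e s_o {p ∈ d.D | p.2 ≤ d.R₁} →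
      |d.redshift x ξ s_e s_o| ≤ C) ∧
    (∃ Rf : ℝ → ℝ, d.IsRegionFamily Rf) ∧
    (∀ Rf : ℝ → ℝ, d.IsRegionFamily Rf →
      ∀ᶠ ε in 𝓝[>] (0 : ℝ),
        ∀ (x ξ : ℝ → Fin 4 → ℝ) (s_e s_o : ℝ), s_e < s_o →
          d.IsRadialNullGeodesic x ξ s_e s_o →
          TolmanBondi.InitialData.RunsIn x s_e s_o (d.DR (Rf ε)) →
          d.redshift x ξ s_e s_o < 0) := by
  exact ⟨TolmanBondi.redshift_bound hd hnaked, hd.exists_isRegionFamily,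
    fun _ hR => TolmanBondi.eventually_blueshift hd hR⟩
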